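/- Let $p,q\ge 1$, $t,s\ge 0$ and put $n=p+q+2t+s$, $r=t+s$ (so $p+q\le n-r$). Let $d\ge 2$ be even, let $d'$ be an integer with $0<d'<d$, and assume $d+1\le p+q$. Write $v\in\mathbb R^n$ as $v=(x_1,\dots,x_{p+q},y_1,\dots,y_{2t},z_1,\dots,z_s)$ and let $$F_0(v)=x_1^d+\cdots+x_p^d-x_{p+1}^d-\cdots-x_{p+q}^d+P_1(y_1,\dots,y_{2t})+P_2(z_1,\dots,z_s),\qquad M_0(v)=(y_{t+1},\dots,y_{2t},z_1,\dots,z_s),$$ where $P_1,P_2$ are real polynomials and $P_1(Ty_1,\dots,Ty_t,y_{t+1},\dots,y_{2t})=O(T^{d'})$ as $T\to\infty$ for all $y_1,\dots,y_{2t}\in\mathbb R$. Let $\mathcal Y^{(F_0,M_0)}$ be the set of pairs $(F,M)$ with $F(v)=\lambda F_0(vg_1)$ and $M(v)=M_0(vg_1)g_2$ for some $\lambda\in\mathbb R\setminus\{0\}$, $g_1\in\mathrm{SL}_n(\mathbb R)$, $g_2\in\mathrm{GL}_r(\mathbb R)$ (matrices act on row vectors from the right). Fix a norm on $\mathbb R^n$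 and let $B_T(0)$ be its ball of radius $T$ about $0$. Write $|I|$ for the Lebesgue measure of $I\subseteq\mathbb R^{r+1}$. For $N,T,\xi>0$ put $$E(N,T,\xi)=\begin{cases}N^{1/2}T^{n-r-d-1/2}&\text{if }p+q>2d-1,\text{ or }p+q=2d-1\text{ and }d-d'>1,\\ N^{1/2}T^{n-r-d-1/2}\log T&\text{if }p+q=2d-1\text{ and }d-d'=1,\\ N^{\xi}T^{n-r-d-\xi}&\text{if }d+1\le p+q<2d-1.\end{cases}$$ Theorem 2.2. Let $(F,M)\in\mathcal Y^{(F_0,M_0)}$. There are constants $c_{F,M}>0$ and $C_{F,M}>0$ with the following property. Let $0<\xi<\min\left\{\frac{(d-d')(p+q-d)}{p+q-1},\frac12\right\}$. For every $N\ge 1$ there is $T_0>0$ such that for every Lebesgue measurable $I\subseteq[-N,N]^{r+1}$ and every $T>T_0N$, $$\left|\mathrm{vol}\left((F,M)^{-1}(I)\cap B_T(0)\right)-c_{F,M}|I|T^{n-r-d}\right|\le C_{F,M}\,|I|\,E(N,T,\xi).$$ If moreover $P_1$ and $P_2$ have total degree at most $d$ (for instance if $F_0$ is homogeneous of degree $d$),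 then $T_0$ can be chosen independently of $N$. -/

import Mathlib

open MeasureTheory Filter
open scoped Matrix

noncomputable section

namespace FormSystem

/-- The index set of the coordinates `(x₁, …, x_{p+q}, y₁, …, y_{2t}, z₁, …, z_s)` of `ℝⁿ`,
`n = p + q + 2t + s`.  The five blocks are `(x₁, …, x_p)`, `(x_{p+1}, …, x_{p+q})`,
`Y₁ = (y₁, …, y_t)`, `Y₂ = (y_{t+1}, …, y_{2t})` and `Z = (z₁, …, z_s)`. -/
abbrev SrcIdx (p q t s : ℕ) : Type :=
  (Fin p ⊕ Fin q) ⊕ ((Fin t ⊕ Fin t) ⊕ Fin s)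

/-- The index set of the coordinates `(y_{t+1}, …, y_{2t}, z₁, …, z_s)` of `ℝʳ`, `r = t + s`. -/
abbrev TgtIdx (t s : ℕ) : Type := Fin t ⊕ Fin s

/-- The polynomial function
`F₀(x, y, z) = (x₁^d + ⋯ + x_p^d - x_{p+1}^d - ⋯ - x_{p+q}^d) + P₁(y₁, …, y_{2t}) + P₂(z)`. -/
def F₀ {p q t s : ℕ} (d : ℕ) (P₁ : MvPolynomial (Fin t ⊕ Fin t) ℝ)
    (P₂ : MvPolynomial (Fin s) ℝ) (v : SrcIdx p q t s → ℝ) : ℝ :=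
  ((∑ i : Fin p, v (Sum.inl (Sum.inl i)) ^ d) - ∑ j : Fin q, v (Sum.inl (Sum.inr j)) ^ d)
    + MvPolynomial.eval (fun k => v (Sum.inr (Sum.inl k))) P₁
    + MvPolynomial.eval (fun k => v (Sum.inr (Sum.inr k))) P₂

/-- The linear map `M₀(x, y, z) = (y_{t+1}, …, y_{2t}, z₁, …, z_s)` from `ℝⁿ` to `ℝʳ`. -/
def M₀ {p q t s : ℕ} : (SrcIdx p q t s → ℝ) →ₗ[ℝ] (TgtIdx t s → ℝ) :=
  LinearMap.funLeft ℝ ℝ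
    (Sum.elim (fun k => Sum.inr (Sum.inl (Sum.inr k))) (fun k => Sum.inr (Sum.inr k)))

/-- `P₁(T Y₁, Y₂) = O(T^{d'})` as `T → ∞`, for all `Y₁, Y₂ ∈ ℝᵗ`. -/
def HasGrowth {t : ℕ} (P₁ : MvPolynomial (Fin t ⊕ Fin t) ℝ) (d' : ℕ) : Prop :=
  ∀ Y₁ Y₂ : Fin t → ℝ,
    (fun T : ℝ => MvPolynomial.eval (Sum.elim (fun k => T * Y₁ k) Y₂) P₁)
      =O[atTop] (fun T : ℝ => T ^ d')

/-- The space of all systems `(F, M) = (lam F₀^{g₁}, g₁ M₀ g₂)` with `lam ≠ 0`, `g₁ ∈ SL_n(ℝ)` and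
`g₂ ∈ GL_r(ℝ)`.  Matrices act on row vectors from the right, so that
`F(v) = lam F₀(v g₁)` and `M(v) = M₀(v g₁) g₂`. -/
def Y (p q t s d : ℕ) (P₁ : MvPolynomial (Fin t ⊕ Fin t) ℝ) (P₂ : MvPolynomial (Fin s) ℝ) :
    Set (((SrcIdx p q t s → ℝ) → ℝ) × ((SrcIdx p q t s → ℝ) →ₗ[ℝ] (TgtIdx t s → ℝ))) :=
  {FM | ∃ (lam : ℝ) (g₁ : Matrix.SpecialLinearGroup (SrcIdx p q t s) ℝ)
      (g₂ : GL (TgtIdx t s) ℝ), lam ≠ 0 ∧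
      (∀ v, FM.1 v = lam * F₀ d P₁ P₂ (v ᵥ* (g₁ : Matrix (SrcIdx p q t s) (SrcIdx p q t s) ℝ))) ∧
      (∀ v, FM.2 v = M₀ (v ᵥ* (g₁ : Matrix (SrcIdx p q t s) (SrcIdx p q t s) ℝ))
        ᵥ* (g₂ : Matrix (TgtIdx t s) (TgtIdx t s) ℝ))}

/-- The size of the error, up to the factor `|I|` and the implied constant, in the three cases. -/
def errorSize (n r p q d d' : ℕ) (ξ N T : ℝ) : ℝ :=
  if p + q < 2 * d - 1 then
    N ^ ξ * T ^ ((n : ℝ) - r - d - ξ)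
  else if p + q = 2 * d - 1 ∧ d - d' = 1 then
    N ^ (1 / 2 : ℝ) * T ^ ((n : ℝ) - r - d - 1 / 2) * Real.log T
  else
    N ^ (1 / 2 : ℝ) * T ^ ((n : ℝ) - r - d - 1 / 2)

/-- `(F, M)⁻¹(I) ∩ B_T(0)`, where `B_T(0)` is the ball of the norm `ν`. -/
def region {p q t s : ℕ} (F : (SrcIdx p q t s → ℝ) → ℝ)
    (M : (SrcIdx p q t s → ℝ) →ₗ[ℝ] (TgtIdx t s → ℝ)) (ν : Seminorm ℝ (SrcIdx p q t s → ℝ))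
    (I : Set (ℝ × (TgtIdx t s → ℝ))) (T : ℝ) : Set (SrcIdx p q t s → ℝ) :=
  {v | (F v, M v) ∈ I} ∩ ν.closedBall 0 T

/-- The subset `[-N, N]^{r+1}` of `ℝ^{r+1} = ℝ × ℝʳ`. -/
def box (t s : ℕ) (N : ℝ) : Set (ℝ × (TgtIdx t s → ℝ)) :=
  {w | |w.1| ≤ N ∧ ∀ i, |w.2 i| ≤ N}

end FormSystem

end

noncomputable section

namespace FormSystem

/-! A determinant-one change of variables in the source and a linear bijection of the target reduce
the problem to `(F₀, M₀)` with an arbitrary norm. Fibre the ball over the values a = (a₁, a₂) of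
`(F₀, M₀)`. Here a₂ is already a group of coordinates, and polar coordinates x' = w^(1/d) φ(u) on
the first p variables, with Σ φᵢ^d = 1, turn F₀ = a₁ into w = b + W, where W is the sum of the d-th
powers of the next q variables and b = a₁ - P₁ - P₂. The volume is therefore the integral over I of
a density, itself the integral of (b + W)^(p/d-1) over the parameters whose point lies in the ball
(`lintegral_region_eq`, `volume_region_eq`).

Rescaling by T extracts T^(p+q-d+t) = T^(n-r-d) and replaces b by b/T^d and a₂ by a₂/T
(`lintegral_cutKernel_scale`). Both become small, so the density approaches its value c at level
zero, which is finite because p + q > d.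

Quantitatively, let the rescaled b and a₂ be at most B and ε in size. Where W < δ, each kernel
contributes O(δ^((p+q-d)/d)), by a beta integral. Where W ≥ δ, the mean value theorem controls the
change of the kernel, and the norm of the point moves by at most Δ = O(B δ^(1/d-1) + ε); this
matters only in a shell of width Δ about the unit sphere, whose mass is O(Δ) by homogeneity. Taking
δ of order B^(d/(p+q-1)) balances the terms and gives a total error O(ε + B^θ), θ = (p+q-d)/(p+q-1)
(`exists_cutKernel_estimate`).

The growth condition bounds the degree of P₁ in Y₁, so with D bounding d and both total degrees, B
is of order N^(D-d')/T^(d-d') and ε of order N/T (`exists_orbit_volume_estimate`). Since θ ≥ 1/2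
exactly when p + q ≥ 2d - 1, comparing (d-d')θ with 1/2 or ξ yields the three cases. If D = d, then
B is of the order of a power of N/T, which makes T₀ uniform in N. -/

/-- The sum of the `d`-th powers of the coordinates. -/
def powSum {ι : Type*} [Fintype ι] (d : ℕ) (x : ι → ℝ) : ℝ := ∑ i, x i ^ d

/-! ### Sums of `d`-th powers and polar coordinates adapted to them -/

section PowSum

variable {ι : Type*} [Fintype ι] {d : ℕ}

lemma continuous_powSum : Continuous (powSum d : (ι → ℝ) → ℝ) := by
  unfold powSum; fun_prop

@[fun_prop]
lemma measurable_powSum : Measurable (powSum d : (ι → ℝ) → ℝ) := continuous_powSum.measurable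

lemma powSum_smul (c : ℝ) (x : ι → ℝ) : powSum d (c • x) = c ^ d * powSum d x := by
  simp [powSum, mul_pow, Finset.mul_sum]

lemma powSum_pos (hd : Even d) {x : ι → ℝ} (hx : x ≠ 0) : 0 < powSum d x := by
  obtain ⟨i, hi⟩ := Function.ne_iff.1 hx
  exact Finset.sum_pos' (fun _ _ => hd.pow_nonneg _) ⟨i, Finset.mem_univ _, hd.pow_pos hi⟩

lemma powSum_le (hd : Even d) {x : ι → ℝ} {L : ℝ} (hx : ‖x‖ ≤ L) :
    powSum d x ≤ Fintype.card ι * L ^ d := by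
  have h : ∀ i, x i ^ d ≤ L ^ d := fun i => by
    rw [← hd.pow_abs]
    exact pow_le_pow_left₀ (abs_nonneg _) ((norm_le_pi_norm x i).trans hx) d
  calc powSum d x ≤ ∑ _i : ι, L ^ d := Finset.sum_le_sum fun i _ => h i
    _ = _ := by simp

end PowSum

/-- The substitution `r = (w / c) ^ (1 / d)` in an integral over a half line. -/
lemma lintegral_Ioi_pow_subst {d : ℕ} (hd : 0 < d) {p : ℕ} (hp : 1 ≤ p) {c : ℝ} (hc : 0 < c)
    (g : ℝ → ENNReal) :
    ∫⁻ r in Set.Ioi (0 : ℝ), g r * ENNReal.ofReal (r ^ (p - 1)) =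
      ENNReal.ofReal ((d : ℝ)⁻¹ * c ^ (-((p : ℝ) / d))) *
        ∫⁻ w in Set.Ioi (0 : ℝ), g (w ^ ((d : ℝ)⁻¹) * c ^ (-(d : ℝ)⁻¹)) *
          ENNReal.ofReal (w ^ ((p : ℝ) / d - 1)) := by
  have hd0 : (0 : ℝ) < d := by exact_mod_cast hd
  set a : ℝ := (d : ℝ)⁻¹ with ha
  have ha0 : 0 < a := by positivity
  set γ : ℝ := c ^ (-a) with hγ
  have hγ0 : 0 < γ := by positivity
  have himg : (fun w : ℝ => w ^ a * γ) '' Set.Ioi 0 = Set.Ioi 0 := by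
    ext r
    constructor
    · rintro ⟨w, hw, rfl⟩
      have : 0 < w := hw
      simp only [Set.mem_Ioi]; positivity
    · intro hr
      have hr : 0 < r := hr
      refine ⟨(r / γ) ^ (d : ℝ), by simp only [Set.mem_Ioi]; positivity, ?_⟩
      simp only
      rw [← Real.rpow_mul (by positivity), ha, mul_inv_cancel₀ hd0.ne', Real.rpow_one]
      field_simp
  have hder : ∀ w ∈ Set.Ioi (0 : ℝ), HasDerivWithinAt (fun w : ℝ => w ^ a * γ)
      (a * w ^ (a - 1) * γ) (Set.Ioi 0) w := fun w hw =>
    ((Real.hasDerivAt_rpow_const (Or.inl (ne_of_gt hw))).mul_const γ).hasDerivWithinAt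
  have hinj : Set.InjOn (fun w : ℝ => w ^ a * γ) (Set.Ioi 0) := by
    intro x hx y hy hxy
    have h1 : x ^ a = y ^ a := mul_right_cancel₀ hγ0.ne' hxy
    exact (Real.rpow_left_inj (le_of_lt hx) (le_of_lt hy) ha0.ne').1 h1
  rw [← himg, lintegral_image_eq_lintegral_abs_deriv_mul measurableSet_Ioi hder hinj, himg,
    ← lintegral_const_mul' _ _ ENNReal.ofReal_ne_top]
  refine setLIntegral_congr_fun measurableSet_Ioi fun w hw => ?_
  have hw : 0 < w := hw
  have key : |a * w ^ (a - 1) * γ| * (w ^ a * γ) ^ (p - 1) =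
      (a * c ^ (-((p : ℝ) / d))) * w ^ ((p : ℝ) / d - 1) := by
    rw [abs_of_pos (by positivity), mul_pow, ← Real.rpow_natCast (w ^ a), ← Real.rpow_natCast γ,
      ← Real.rpow_mul hw.le, hγ, ← Real.rpow_mul hc.le, Nat.cast_sub hp]
    have e1 : w ^ ((p : ℝ) / d - 1) = w ^ (a - 1) * w ^ (a * ((p : ℝ) - (1 : ℕ))) := by
      rw [← Real.rpow_add hw]; congr 1; rw [ha]; push_cast; field_simp; ring
    have e2 : c ^ (-((p : ℝ) / d)) = c ^ (-a) * c ^ (-a * ((p : ℝ) - (1 : ℕ))) := by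
      rw [← Real.rpow_add hc]; congr 1; rw [ha]; push_cast; field_simp; ring
    rw [e1, e2]; ring
  calc ENNReal.ofReal |a * w ^ (a - 1) * γ| * (g (w ^ a * γ) * ENNReal.ofReal ((w ^ a * γ) ^ (p - 1)))
      = g (w ^ a * γ) * ENNReal.ofReal (|a * w ^ (a - 1) * γ| * (w ^ a * γ) ^ (p - 1)) := by
        rw [ENNReal.ofReal_mul (abs_nonneg _)]; ring
    _ = _ := by
        rw [key, ENNReal.ofReal_mul (by positivity)]; ring

/-- Polar coordinates on `ℝᵖ` adapted to the form `x₁ ^ d + ⋯ + x_p ^ d`. -/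
lemma exists_polar {d : ℕ} (hd : 0 < d) (hde : Even d) {p : ℕ} (hp : 1 ≤ p) :
    ∃ (μ : Measure (Metric.sphere (0 : Fin p → ℝ) 1))
      (φ : Metric.sphere (0 : Fin p → ℝ) 1 → (Fin p → ℝ)) (R : ℝ),
      IsFiniteMeasure μ ∧ μ ≠ 0 ∧ Measurable φ ∧ (∀ u, ‖φ u‖ ≤ R) ∧ (∀ u, powSum d (φ u) = 1) ∧
      ∀ f : (Fin p → ℝ) → ENNReal, Measurable f →
        ∫⁻ x, f x = ∫⁻ u, (∫⁻ w in Set.Ioi (0 : ℝ), f (w ^ ((d : ℝ)⁻¹) • φ u) *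
          ENNReal.ofReal (w ^ ((p : ℝ) / d - 1))) ∂μ := by
  have : Nonempty (Fin p) := ⟨⟨0, hp⟩⟩
  have hd0 : (0 : ℝ) < d := by exact_mod_cast hd
  set S := Metric.sphere (0 : Fin p → ℝ) 1
  have hne : ∀ u : S, (u : Fin p → ℝ) ≠ 0 := fun u h => by
    have := u.2
    rw [h] at this
    simp [S] at this
  have hA : ∀ u : S, 0 < powSum d (u : Fin p → ℝ) := fun u => powSum_pos hde (hne u)
  have hAc : Continuous fun u : S => powSum d (u : Fin p → ℝ) :=
    continuous_powSum.comp continuous_subtype_val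
  have hc1 : ∀ e : ℝ, Continuous fun u : S => powSum d (u : Fin p → ℝ) ^ e := fun e =>
    hAc.rpow_const fun u => Or.inl (hA u).ne'
  -- With A = `powSum d u`, the radial substitution r = (w / A)^(1/d) has r^(p-1) dr = d⁻¹ A^(-p/d)
  -- w^(p/d-1) dw. The factor free of w becomes the density `ω` on the sphere, and A^(-1/d) rescales
  -- u to the level set `powSum = 1`.
  set ω : S → ℝ := fun u => (d : ℝ)⁻¹ * powSum d (u : Fin p → ℝ) ^ (-((p : ℝ) / d)) with hω
  have hωc : Continuous ω := continuous_const.mul (hc1 _)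
  have hω0 : ∀ u, 0 < ω u := fun u => by have := hA u; simp only [hω]; positivity
  set φ : S → (Fin p → ℝ) := fun u => powSum d (u : Fin p → ℝ) ^ (-(d : ℝ)⁻¹) • (u : Fin p → ℝ)
    with hφ
  have hφc : Continuous φ := (hc1 _).smul continuous_subtype_val
  obtain ⟨R, hR⟩ := (isCompact_range hφc).isBounded.exists_norm_le
  obtain ⟨M, hM⟩ := (isCompact_range hωc).isBounded.exists_norm_le
  set μ₀ : Measure S := (volume : Measure (Fin p → ℝ)).toSphere with hμ₀
  have hωm : Measurable fun u => ENNReal.ofReal (ω u) := hωc.measurable.ennreal_ofReal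
  refine ⟨μ₀.withDensity fun u => ENNReal.ofReal (ω u), φ, R, ?_, ?_, hφc.measurable,
    fun u => hR _ ⟨u, rfl⟩, ?_, ?_⟩
  · refine isFiniteMeasure_withDensity (ne_of_lt ?_)
    calc ∫⁻ u, ENNReal.ofReal (ω u) ∂μ₀ ≤ ∫⁻ _u, ENNReal.ofReal M ∂μ₀ :=
          lintegral_mono fun u => ENNReal.ofReal_le_ofReal
            ((le_abs_self _).trans (hM _ ⟨u, rfl⟩))
      _ < ⊤ := by
          rw [lintegral_const]
          exact ENNReal.mul_lt_top ENNReal.ofReal_lt_top (measure_lt_top _ _)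
  · rw [Ne, withDensity_eq_zero_iff hωm.aemeasurable]
    intro h
    have h2 : ∀ᵐ u ∂μ₀, False := by
      filter_upwards [h] with u hu
      have := hω0 u
      simp at hu
      linarith
    have h3 : μ₀ = 0 := by simpa using h2
    exact Measure.toSphere_ne_zero _ h3
  · intro u
    simp only [hφ]
    rw [powSum_smul, ← Real.rpow_natCast, ← Real.rpow_mul (hA u).le, neg_mul,
      inv_mul_cancel₀ hd0.ne', Real.rpow_neg_one, inv_mul_cancel₀ (hA u).ne']
  · intro f hf
    -- Ordinary polar coordinates, for the unit sphere of the sup norm.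
    have h1 : ∫⁻ x, f x = ∫⁻ u, (∫⁻ r in Set.Ioi (0 : ℝ), f (r • (u : Fin p → ℝ)) *
        ENNReal.ofReal (r ^ (p - 1))) ∂μ₀ := by
      have mp := (volume : Measure (Fin p → ℝ)).measurePreserving_homeomorphUnitSphereProd
      have e := (Homeomorph.measurableEmbedding (homeomorphUnitSphereProd (Fin p → ℝ)))
      have hfm : Measurable fun z : S × Set.Ioi (0 : ℝ) => f (z.2.1 • (z.1 : Fin p → ℝ)) := by
        fun_prop
      have h2 : ∫⁻ x, f x = ∫⁻ x : ({0}ᶜ : Set (Fin p → ℝ)), f x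
          ∂((volume : Measure (Fin p → ℝ)).comap (↑)) := by
        rw [lintegral_subtype_comap (measurableSet_singleton _).compl,
          restrict_compl_singleton]
      rw [h2]
      have h3 := mp.lintegral_comp hfm
      simp only [Module.finrank_fin_fun] at h3
      have h4 : ∀ x : ({0}ᶜ : Set (Fin p → ℝ)),
          ((homeomorphUnitSphereProd (Fin p → ℝ)) x).2.1 •
            (((homeomorphUnitSphereProd (Fin p → ℝ)) x).1 : Fin p → ℝ) = x := by
        intro x
        have hx : ‖(x : Fin p → ℝ)‖ ≠ 0 := norm_ne_zero_iff.2 x.2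
        simp [smul_smul, mul_inv_cancel₀ hx]
      simp only [h4] at h3
      rw [h3, lintegral_prod _ hfm.aemeasurable]
      refine lintegral_congr fun u => ?_
      rw [Measure.volumeIoiPow, lintegral_withDensity_eq_lintegral_mul _ (by fun_prop) (by fun_prop)]
      rw [← lintegral_subtype_comap measurableSet_Ioi]
      refine lintegral_congr fun r => ?_
      simp [mul_comm]
    rw [h1, lintegral_withDensity_eq_lintegral_mul _ hωm]
    · refine lintegral_congr fun u => ?_
      rw [lintegral_Ioi_pow_subst hd hp (hA u)]
      simp only [Pi.mul_apply, hφ, smul_smul]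
      rfl
    · refine Measurable.lintegral_prod_right' (f := fun z : S × ℝ =>
        f (z.2 ^ ((d : ℝ)⁻¹) • φ z.1) * ENNReal.ofReal (z.2 ^ ((p : ℝ) / d - 1))) ?_
      have := hφc.measurable
      fun_prop

/-! ### One-variable estimates for truncated powers -/

/-- The function `w ↦ w ^ α` on the positive half line, extended by zero. -/
def posRpow (α w : ℝ) : ℝ := if 0 < w then w ^ α else 0

lemma posRpow_nonneg (α w : ℝ) : 0 ≤ posRpow α w := by
  unfold posRpow; split_ifs with h
  · positivity
  · exact le_rfl

lemma posRpow_of_pos (α : ℝ) {w : ℝ} (hw : 0 < w) : posRpow α w = w ^ α := if_pos hw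

lemma posRpow_of_nonpos (α : ℝ) {w : ℝ} (hw : w ≤ 0) : posRpow α w = 0 := if_neg hw.not_gt

@[fun_prop]
lemma measurable_posRpow (α : ℝ) : Measurable (posRpow α) :=
  Measurable.ite measurableSet_Ioi (by fun_prop) measurable_const

lemma posRpow_mul {α c : ℝ} (hc : 0 < c) (w : ℝ) :
    posRpow α (c * w) = c ^ α * posRpow α w := by
  rcases le_or_gt w 0 with hw | hw
  · rw [posRpow_of_nonpos _ hw, posRpow_of_nonpos _ (mul_nonpos_of_nonneg_of_nonpos hc.le hw),
      mul_zero]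
  · rw [posRpow_of_pos _ hw, posRpow_of_pos _ (mul_pos hc hw), Real.mul_rpow hc.le hw.le]

lemma exists_abs_rpow_sub_one_le (β : ℝ) :
    ∃ C : ℝ, 0 < C ∧ ∀ x ∈ Set.Icc (1 / 2 : ℝ) (3 / 2), |x ^ β - 1| ≤ C * |x - 1| := by
  have hcont : ContinuousOn (fun x : ℝ => β * x ^ (β - 1)) (Set.Icc (1 / 2 : ℝ) (3 / 2)) :=
    continuousOn_const.mul (continuousOn_id.rpow_const fun x hx =>
      Or.inl (by have := hx.1; simp only [id]; linarith))
  obtain ⟨C, hC⟩ := isCompact_Icc.exists_bound_of_continuousOn hcont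
  refine ⟨|C| + 1, by positivity, fun x hx => ?_⟩
  have h := (convex_Icc (1 / 2 : ℝ) (3 / 2)).norm_image_sub_le_of_norm_hasDerivWithin_le
    (f := fun x : ℝ => x ^ β) (f' := fun x => β * x ^ (β - 1)) (C := |C| + 1)
    (fun x hx => (Real.hasDerivAt_rpow_const
      (Or.inl (by have := hx.1; linarith))).hasDerivWithinAt)
    (fun x hx => (hC x hx).trans ((le_abs_self C).trans (by linarith)))
    (x := 1) (y := x) (by norm_num) hx
  simpa using h

/-- Dividing by W reduces to a Lipschitz bound for x ↦ x^β at x = 1 on [1/2, 3/2], where the power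
is smooth whatever the sign of β. -/
lemma exists_abs_rpow_add_sub_le (β : ℝ) :
    ∃ C : ℝ, 0 < C ∧ ∀ b W : ℝ, 0 < W → |b| ≤ W / 2 →
      |(b + W) ^ β - W ^ β| ≤ C * |b| * W ^ (β - 1) := by
  obtain ⟨C, hC0, hC⟩ := exists_abs_rpow_sub_one_le β
  refine ⟨C, hC0, fun b W hW hb => ?_⟩
  have hb' := abs_le.1 hb
  have hx : (b + W) / W ∈ Set.Icc (1 / 2 : ℝ) (3 / 2) := by
    constructor
    · rw [le_div_iff₀ hW]; linarith
    · rw [div_le_iff₀ hW]; linarith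
  have h0 : 0 < (b + W) / W := by have := hx.1; linarith
  have e1 : (b + W) ^ β = W ^ β * ((b + W) / W) ^ β := by
    rw [← Real.mul_rpow hW.le h0.le]; congr 1; field_simp
  have e2 : |(b + W) / W - 1| = |b| / W := by
    rw [add_div, div_self hW.ne', add_sub_cancel_right, abs_div, abs_of_pos hW]
  calc |(b + W) ^ β - W ^ β| = W ^ β * |((b + W) / W) ^ β - 1| := by
        rw [e1, ← abs_of_pos (Real.rpow_pos_of_pos hW β), ← abs_mul, abs_of_pos
          (Real.rpow_pos_of_pos hW β)]; ring_nf
    _ ≤ W ^ β * (C * (|b| / W)) := by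
        have := hC _ hx
        rw [e2] at this
        gcongr
    _ = _ := by rw [Real.rpow_sub_one hW.ne']; ring

lemma lintegral_Ioc_rpow {σ M : ℝ} (hσ : -1 < σ) (hM : 0 ≤ M) :
    ∫⁻ w in Set.Ioc 0 M, ENNReal.ofReal (w ^ σ) = ENNReal.ofReal (M ^ (σ + 1) / (σ + 1)) := by
  have hi : IntervalIntegrable (fun x : ℝ => x ^ σ) volume 0 M :=
    intervalIntegral.intervalIntegrable_rpow' hσ
  rw [← ofReal_integral_eq_lintegral_ofReal hi.1 ?_, ← intervalIntegral.integral_of_le hM,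
    integral_rpow (Or.inl hσ), Real.zero_rpow (by linarith), sub_zero]
  filter_upwards [ae_restrict_mem measurableSet_Ioc] with y hy
  exact Real.rpow_nonneg hy.1.le _

/-- Decouples two possibly singular factors. A factor with nonnegative exponent is bounded by its
value at M; if both exponents are negative, the larger variable is replaced by the smaller. Each
term on the right then involves only one variable. -/
lemma mul_rpow_le_sum {α γ x y M : ℝ} (hx : 0 < x) (hy : 0 < y) (hxM : x ≤ M) (hyM : y ≤ M) :
    x ^ α * y ^ γ ≤ M ^ α * y ^ γ + M ^ γ * x ^ α + x ^ (α + γ) + y ^ (α + γ) := by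
  have hM : 0 < M := hx.trans_le hxM
  have p1 : 0 < M ^ α * y ^ γ := by positivity
  have p2 : 0 < M ^ γ * x ^ α := by positivity
  have p3 : 0 < x ^ (α + γ) := by positivity
  have p4 : 0 < y ^ (α + γ) := by positivity
  rcases le_or_gt 0 α with hα | hα
  · have : x ^ α * y ^ γ ≤ M ^ α * y ^ γ := by gcongr
    linarith
  rcases le_or_gt 0 γ with hγ | hγ
  · have : y ^ γ * x ^ α ≤ M ^ γ * x ^ α := by gcongr
    linarith
  rcases le_total x y with h | h
  · have : x ^ α * y ^ γ ≤ x ^ α * x ^ γ :=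
      mul_le_mul_of_nonneg_left (Real.rpow_le_rpow_of_nonpos hx h hγ.le) (by positivity)
    rw [← Real.rpow_add hx] at this
    linarith
  · have : x ^ α * y ^ γ ≤ y ^ α * y ^ γ :=
      mul_le_mul_of_nonneg_right (Real.rpow_le_rpow_of_nonpos hy h hα.le) (by positivity)
    rw [← Real.rpow_add hy] at this
    linarith

/-- A beta integral with a shifted singularity. -/
lemma exists_lintegral_posRpow_mul_le {α γ : ℝ} (hα : -1 < α) (hγ : -1 < γ) (hαγ : -1 < α + γ) :
    ∃ C : ℝ, 0 < C ∧ ∀ b D : ℝ, 0 < D → |b| ≤ D →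
      ∫⁻ W in Set.Ioo 0 D, ENNReal.ofReal (posRpow α (b + W)) * ENNReal.ofReal (W ^ γ) ≤
        ENNReal.ofReal (C * D ^ (α + γ + 1)) := by
  set a1 := α + 1
  set g1 := γ + 1
  set s1 := α + γ + 1
  have ha1 : 0 < a1 := by simp only [a1]; linarith
  have hg1 : 0 < g1 := by simp only [g1]; linarith
  have hs1 : 0 < s1 := by simp only [s1]; linarith
  refine ⟨2 ^ s1 * (1 / g1 + 1 / a1 + 1 / s1 + 1 / s1), by positivity, fun b D hD hb => ?_⟩
  -- Both W and b + W are at most 2D. After decoupling, translation invariance removes b from the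
  -- terms in b + W, so the bound is uniform in b.
  set M := 2 * D with hMdef
  have hM : 0 < M := by positivity
  have hb' := abs_le.1 hb
  set f : ℝ → ENNReal := fun y => ENNReal.ofReal (M ^ α) * ENNReal.ofReal (y ^ γ)
    + ENNReal.ofReal (y ^ (α + γ)) with hf
  set g : ℝ → ENNReal := fun x => ENNReal.ofReal (M ^ γ) * ENNReal.ofReal (x ^ α)
    + ENNReal.ofReal (x ^ (α + γ)) with hg
  have hfm : Measurable f := by simp only [hf]; fun_prop
  have hgm : Measurable g := by simp only [hg]; fun_prop
  have key : ∀ W ∈ Set.Ioo 0 D, ENNReal.ofReal (posRpow α (b + W)) * ENNReal.ofReal (W ^ γ) ≤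
      (Set.Ioc 0 M).indicator f W + (Set.Ioc 0 M).indicator g (b + W) := by
    intro W hW
    have hWM : W ∈ Set.Ioc 0 M := ⟨hW.1, by have := hW.2; simp only [hMdef]; linarith⟩
    rcases le_or_gt (b + W) 0 with h | h
    · rw [posRpow_of_nonpos _ h]; simp
    · have hbM : b + W ∈ Set.Ioc 0 M := ⟨h, by have := hW.2; simp only [hMdef]; linarith⟩
      have hW0 := hW.1
      rw [posRpow_of_pos _ h, Set.indicator_of_mem hWM, Set.indicator_of_mem hbM, hf, hg]
      simp only
      rw [← ENNReal.ofReal_mul (by positivity), ← ENNReal.ofReal_mul (by positivity),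
        ← ENNReal.ofReal_mul (by positivity), ← ENNReal.ofReal_add (by positivity) (by positivity),
        ← ENNReal.ofReal_add (by positivity) (by positivity),
        ← ENNReal.ofReal_add (by positivity) (by positivity)]
      apply ENNReal.ofReal_le_ofReal
      have := mul_rpow_le_sum (α := α) (γ := γ) h hW.1 hbM.2 hWM.2
      linarith
  calc ∫⁻ W in Set.Ioo 0 D, ENNReal.ofReal (posRpow α (b + W)) * ENNReal.ofReal (W ^ γ)
      ≤ ∫⁻ W in Set.Ioo 0 D, ((Set.Ioc 0 M).indicator f W + (Set.Ioc 0 M).indicator g (b + W)) :=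
        setLIntegral_mono' measurableSet_Ioo key
    _ ≤ ∫⁻ W, ((Set.Ioc 0 M).indicator f W + (Set.Ioc 0 M).indicator g (b + W)) :=
        setLIntegral_le_lintegral _ _
    _ = (∫⁻ W in Set.Ioc 0 M, f W) + ∫⁻ W in Set.Ioc 0 M, g W := by
        rw [lintegral_add_left (hfm.indicator measurableSet_Ioc),
          lintegral_add_left_eq_self (μ := volume) ((Set.Ioc 0 M).indicator g) b,
          lintegral_indicator measurableSet_Ioc, lintegral_indicator measurableSet_Ioc]
    _ = ENNReal.ofReal (2 ^ s1 * (1 / g1 + 1 / a1 + 1 / s1 + 1 / s1) * D ^ s1) := by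
        simp only [hf, hg]
        rw [lintegral_add_right _ (by fun_prop), lintegral_add_right _ (by fun_prop),
          lintegral_const_mul' _ _ ENNReal.ofReal_ne_top,
          lintegral_const_mul' _ _ ENNReal.ofReal_ne_top,
          lintegral_Ioc_rpow hγ hM.le, lintegral_Ioc_rpow hα hM.le, lintegral_Ioc_rpow hαγ hM.le,
          ← ENNReal.ofReal_mul (by positivity), ← ENNReal.ofReal_mul (by positivity),
          ← ENNReal.ofReal_add (by positivity) (by positivity),
          ← ENNReal.ofReal_add (by positivity) (by positivity),
          ← ENNReal.ofReal_add (by positivity) (by positivity)]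
        congr 1
        have e1 : M ^ α * M ^ (γ + 1) = M ^ s1 := by
          rw [← Real.rpow_add hM]; congr 1; simp only [s1]; ring
        have e2 : M ^ γ * M ^ (α + 1) = M ^ s1 := by
          rw [← Real.rpow_add hM]; congr 1; simp only [s1]; ring
        have e3 : M ^ s1 = 2 ^ s1 * D ^ s1 := by rw [hMdef, Real.mul_rpow (by norm_num) hD.le]
        change M ^ α * (M ^ (γ + 1) / g1) + M ^ s1 / s1 + (M ^ γ * (M ^ (α + 1) / a1) + M ^ s1 / s1)
          = _
        rw [← mul_div_assoc, ← mul_div_assoc, e1, e2, e3]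
        ring

lemma lintegral_Ici_rpow_le {σ D : ℝ} (hσ : σ < -1) (hD : 0 < D) :
    ∫⁻ W in Set.Ici D, ENNReal.ofReal (W ^ σ) = ENNReal.ofReal (D ^ (σ + 1) / (-(σ + 1))) := by
  rw [setLIntegral_congr Ioi_ae_eq_Ici.symm,
    ← ofReal_integral_eq_lintegral_ofReal (integrableOn_Ioi_rpow_of_lt hσ hD) ?_,
    integral_Ioi_rpow_of_lt hσ hD]
  · congr 1; rw [div_neg, neg_div]
  filter_upwards [ae_restrict_mem measurableSet_Ioi] with y hy
  exact Real.rpow_nonneg (hD.trans hy).le _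

/-- The exponent is lowered to an integrable τ < -1 at the cost of a power of M. This avoids
distinguishing σ < -1, σ = -1 (a logarithm) and σ > -1. -/
lemma lintegral_Icc_rpow_le {σ τ D M : ℝ} (hτ : τ < -1) (hστ : τ ≤ σ) (hD : 0 < D) :
    ∫⁻ W in Set.Icc D M, ENNReal.ofReal (W ^ σ) ≤
      ENNReal.ofReal (M ^ (σ - τ) * (D ^ (τ + 1) / (-(τ + 1)))) := by
  rcases le_or_gt M 0 with hM | hM
  · rw [Set.Icc_eq_empty (by linarith)]; simp
  rw [ENNReal.ofReal_mul (by positivity), ← lintegral_Ici_rpow_le hτ hD,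
    ← lintegral_const_mul' _ _ ENNReal.ofReal_ne_top]
  refine (setLIntegral_mono' measurableSet_Icc fun W hW => ?_).trans
    (lintegral_mono_set Set.Icc_subset_Ici_self)
  have hW0 : 0 < W := hD.trans_le hW.1
  rw [← ENNReal.ofReal_mul (by positivity)]
  apply ENNReal.ofReal_le_ofReal
  calc W ^ σ = W ^ (σ - τ) * W ^ τ := by rw [← Real.rpow_add hW0]; congr 1; ring
    _ ≤ M ^ (σ - τ) * W ^ τ := by
      gcongr
      exact hW.2

/-- In adapted polar coordinates `powSum` is the radial variable w itself, so the sphere contributes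
only its total mass. -/
lemma exists_lintegral_powSum {d : ℕ} (hd : 0 < d) (hde : Even d) {q : ℕ} (hq : 1 ≤ q) :
    ∃ c : ℝ, 0 ≤ c ∧ ∀ g : ℝ → ENNReal, Measurable g →
      ∫⁻ x : Fin q → ℝ, g (powSum d x) = ENNReal.ofReal c *
        ∫⁻ W in Set.Ioi (0 : ℝ), g W * ENNReal.ofReal (W ^ ((q : ℝ) / d - 1)) := by
  obtain ⟨μ, φ, R, hμ, -, -, -, hφ, h⟩ := exists_polar hd hde hq
  refine ⟨μ.real Set.univ, measureReal_nonneg, fun g hg => ?_⟩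
  rw [h (fun x => g (powSum d x)) (by fun_prop)]
  have : ∀ u, ∫⁻ w in Set.Ioi (0 : ℝ), g (powSum d (w ^ ((d : ℝ)⁻¹) • φ u)) *
      ENNReal.ofReal (w ^ ((q : ℝ) / d - 1)) =
      ∫⁻ w in Set.Ioi (0 : ℝ), g w * ENNReal.ofReal (w ^ ((q : ℝ) / d - 1)) := fun u =>
    setLIntegral_congr_fun measurableSet_Ioi fun w hw => by
      have hw : 0 < w := hw
      simp only [powSum_smul, hφ, mul_one]
      rw [Real.rpow_inv_natCast_pow hw.le hd.ne']
  simp only [this, lintegral_const]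
  rw [mul_comm, ofReal_measureReal]

/-- A bound, as a function of `W`, for the error made on replacing `(b + W) ^ α` by `W ^ α`. -/
def kernelError (α C D B M b W : ℝ) : ENNReal :=
  if W < D then ENNReal.ofReal (posRpow α (b + W)) + ENNReal.ofReal (posRpow α W)
  else if W ≤ M then ENNReal.ofReal (C * B * W ^ (α - 1)) else 0

lemma measurable_kernelError {α C D B M : ℝ} :
    Measurable fun z : ℝ × ℝ => kernelError α C D B M z.1 z.2 := by
  unfold kernelError
  refine Measurable.ite (measurableSet_lt measurable_snd measurable_const) (by fun_prop) ?_
  exact Measurable.ite (measurableSet_le measurable_snd measurable_const) (by fun_prop)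
    measurable_const

/-- The threshold D = 2 B^(d/(p+q-1)) is chosen so that D^((p+q-d)/d), from the beta integral below
D, and B D^(1/d-1), which bounds the part above D, are both of order B^θ. -/
lemma exists_lintegral_kernelError_le {d : ℕ} (hd : 2 ≤ d) {p q : ℕ} (hp : 1 ≤ p) (hq : 1 ≤ q)
    (hpq : d + 1 ≤ p + q) {C₁ M : ℝ} (hC₁ : 0 < C₁) (hM : 0 ≤ M) :
    ∃ C : ℝ, 0 < C ∧ ∀ B b : ℝ, 0 < B → B ≤ 1 → |b| ≤ B →
      ∫⁻ W in Set.Ioi (0 : ℝ),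
        kernelError ((p : ℝ) / d - 1) C₁ (2 * B ^ ((d : ℝ) / (p + q - 1))) B M b W *
          ENNReal.ofReal (W ^ ((q : ℝ) / d - 1)) ≤
        ENNReal.ofReal (C * B ^ (((p : ℝ) + q - d) / (p + q - 1))) := by
  have hd0 : (2 : ℝ) ≤ d := by exact_mod_cast hd
  have hdp : (0 : ℝ) < d := by linarith
  have hp0 : (1 : ℝ) ≤ p := by exact_mod_cast hp
  have hq0 : (1 : ℝ) ≤ q := by exact_mod_cast hq
  have hm : (d : ℝ) + 1 ≤ p + q := by exact_mod_cast hpq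
  set α : ℝ := (p : ℝ) / d - 1 with hα
  set γ : ℝ := (q : ℝ) / d - 1 with hγ
  have hα1 : -1 < α := by
    have : (0 : ℝ) < p / d := by positivity
    linarith
  have hγ1 : -1 < γ := by
    have : (0 : ℝ) < q / d := by positivity
    linarith
  have hαγ : α + γ + 1 = ((p : ℝ) + q - d) / d := by rw [hα, hγ]; field_simp; ring
  have hαγ1 : -1 < α + γ := by
    have : (0 : ℝ) < ((p : ℝ) + q - d) / d := div_pos (by linarith) hdp
    linarith
  have hm1 : (0 : ℝ) < (p : ℝ) + q - 1 := by linarith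
  set θ : ℝ := ((p : ℝ) + q - d) / (p + q - 1) with hθ
  -- Chosen so that B D^(τ+1) has order B^θ. The inequality τ ≤ σ is precisely d + 1 ≤ p + q.
  set τ : ℝ := 1 / d - 2 with hτdef
  have hd1 : (1 : ℝ) / d ≤ 1 / 2 := one_div_le_one_div_of_le (by norm_num) hd0
  have hτ : τ < -1 := by simp only [hτdef]; linarith
  set σ : ℝ := α - 1 + γ with hσ
  have hστ : τ ≤ σ := by
    have : σ - τ = ((p : ℝ) + q - 1 - d) / d := by rw [hσ, hτdef, hα, hγ]; field_simp; ring
    have h2 : 0 ≤ ((p : ℝ) + q - 1 - d) / d := div_nonneg (by linarith) hdp.le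
    linarith
  obtain ⟨C, hC0, hC⟩ := exists_lintegral_posRpow_mul_le hα1 hγ1 hαγ1
  set e : ℝ := (d : ℝ) / (p + q - 1) with he
  have hτ1 : 0 < -(τ + 1) := by linarith
  refine ⟨2 * C * 2 ^ (α + γ + 1) + C₁ * (M ^ (σ - τ) * (2 ^ (τ + 1) / (-(τ + 1)))),
    by positivity, fun B b hB hB1 hb => ?_⟩
  set D : ℝ := 2 * B ^ e with hD
  have hD0 : 0 < D := by positivity
  have hBD : B ≤ B ^ e := by
    conv_lhs => rw [← Real.rpow_one B]
    exact Real.rpow_le_rpow_of_exponent_ge hB hB1 (by rw [he, div_le_one hm1]; linarith)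
  have hbD : |b| ≤ D := by
    have : 0 < B ^ e := by positivity
    linarith
  have hsplit : Set.Ioi (0 : ℝ) = Set.Ioo 0 D ∪ Set.Ici D := by
    rw [Set.Ioo_union_Ici_eq_Ioi hD0]
  have eD1 : D ^ (α + γ + 1) = 2 ^ (α + γ + 1) * B ^ θ := by
    rw [hD, Real.mul_rpow (by norm_num) (by positivity), ← Real.rpow_mul hB.le, hαγ]
    congr 2; rw [he, hθ]; field_simp
  have eD2 : B * D ^ (τ + 1) = 2 ^ (τ + 1) * B ^ θ := by
    rw [hD, Real.mul_rpow (by norm_num) (by positivity), ← Real.rpow_mul hB.le, mul_left_comm]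
    congr 1
    nth_rewrite 1 [← Real.rpow_one B]
    rw [← Real.rpow_add hB]
    congr 1; rw [he, hθ, hτdef]; field_simp; ring
  rw [hsplit]
  refine (lintegral_union_le _ _ _).trans ?_
  have I1 : ∫⁻ W in Set.Ioo 0 D, kernelError α C₁ D B M b W * ENNReal.ofReal (W ^ γ) ≤
      ENNReal.ofReal (2 * C * 2 ^ (α + γ + 1) * B ^ θ) := by
    calc _ ≤ ∫⁻ W in Set.Ioo 0 D, (ENNReal.ofReal (posRpow α (b + W)) * ENNReal.ofReal (W ^ γ) +
            ENNReal.ofReal (posRpow α (0 + W)) * ENNReal.ofReal (W ^ γ)) := by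
          refine setLIntegral_mono' measurableSet_Ioo fun W hW => ?_
          rw [kernelError, if_pos hW.2, add_mul, zero_add]
      _ ≤ ENNReal.ofReal (C * D ^ (α + γ + 1)) + ENNReal.ofReal (C * D ^ (α + γ + 1)) := by
          rw [lintegral_add_left (by fun_prop)]
          exact add_le_add (hC b D hD0 hbD) (hC 0 D hD0 (by simpa using hD0.le))
      _ = _ := by
          rw [← ENNReal.ofReal_add (by positivity) (by positivity), eD1]; congr 1; ring
  have I2 : ∫⁻ W in Set.Ici D, kernelError α C₁ D B M b W * ENNReal.ofReal (W ^ γ) ≤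
      ENNReal.ofReal (C₁ * (M ^ (σ - τ) * (2 ^ (τ + 1) / (-(τ + 1)))) * B ^ θ) := by
    calc _ ≤ ∫⁻ W in Set.Ici D, (Set.Icc D M).indicator
            (fun W => ENNReal.ofReal (C₁ * B) * ENNReal.ofReal (W ^ σ)) W := by
          refine setLIntegral_mono' measurableSet_Ici fun W hW => ?_
          have hW : D ≤ W := hW
          have hW0 := hD0.trans_le hW
          rw [kernelError, if_neg hW.not_gt]
          split_ifs with h
          · rw [Set.indicator_of_mem (show W ∈ Set.Icc D M from ⟨hW, h⟩),
              ← ENNReal.ofReal_mul (by positivity), ← ENNReal.ofReal_mul (by positivity), mul_assoc,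
              ← Real.rpow_add hW0]
          · simp
      _ ≤ ∫⁻ W in Set.Icc D M, ENNReal.ofReal (C₁ * B) * ENNReal.ofReal (W ^ σ) := by
          rw [← lintegral_indicator measurableSet_Icc]
          exact setLIntegral_le_lintegral _ _
      _ ≤ ENNReal.ofReal (C₁ * B) *
            ENNReal.ofReal (M ^ (σ - τ) * (D ^ (τ + 1) / (-(τ + 1)))) := by
          rw [lintegral_const_mul' _ _ ENNReal.ofReal_ne_top]
          gcongr
          exact lintegral_Icc_rpow_le hτ hστ hD0
      _ = _ := by
          rw [← ENNReal.ofReal_mul (by positivity)]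
          congr 1
          calc _ = C₁ * (M ^ (σ - τ) * ((B * D ^ (τ + 1)) / (-(τ + 1)))) := by ring
            _ = _ := by rw [eD2]; ring
  refine (add_le_add I1 I2).trans ?_
  rw [← ENNReal.ofReal_add (by positivity) (by positivity)]
  apply ENNReal.ofReal_le_ofReal
  rw [← add_mul]

/-! ### The kernel of the density and its scaling -/

lemma lintegral_smul_eq {E : Type*} [NormedAddCommGroup E] [NormedSpace ℝ E]
    [MeasurableSpace E] [BorelSpace E] [FiniteDimensional ℝ E] (μ : Measure E)
    [μ.IsAddHaarMeasure] {T : ℝ} (hT : 0 < T) (f : E → ENNReal) :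
    ∫⁻ z, f z ∂μ = ENNReal.ofReal (T ^ Module.finrank ℝ E) * ∫⁻ z, f (T • z) ∂μ := by
  have h1 : ∫⁻ z, f (T • z) ∂μ = ∫⁻ z, f z ∂(μ.map (T • ·)) :=
    ((Homeomorph.smulOfNeZero T hT.ne').measurableEmbedding.lintegral_map f).symm
  rw [h1, Measure.map_addHaar_smul μ hT.ne', lintegral_smul_measure, smul_eq_mul, ← mul_assoc,
    ← ENNReal.ofReal_mul (by positivity), abs_of_pos (by positivity),
    mul_inv_cancel₀ (by positivity), ENNReal.ofReal_one, one_mul]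

lemma one_add_pow_sub_le (n : ℕ) {x : ℝ} (hx : 0 ≤ x) (hx1 : x ≤ 1) :
    (1 + x) ^ n - (1 - x) ^ n ≤ n * 2 ^ n * x := by
  induction n with
  | zero => simp
  | succ n ih =>
    have h1 : (1 - x) ^ n ≤ 1 := pow_le_one₀ (by linarith) (by linarith)
    have h2 : (1 : ℝ) ≤ 2 ^ n := one_le_pow₀ (by norm_num)
    have h3 : (1 + x) * ((1 + x) ^ n - (1 - x) ^ n) ≤ 2 * (n * 2 ^ n * x) := by
      refine mul_le_mul (by linarith) ih ?_ (by norm_num)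
      exact sub_nonneg.2 (pow_le_pow_left₀ (by linarith) (by linarith) n)
    have h4 : (1 - x) ^ n * (2 * x) ≤ 2 ^ n * (2 * x) := by gcongr; linarith
    push_cast
    calc (1 + x) ^ (n + 1) - (1 - x) ^ (n + 1)
        = (1 + x) * ((1 + x) ^ n - (1 - x) ^ n) + (1 - x) ^ n * (2 * x) := by ring
      _ ≤ 2 * (n * 2 ^ n * x) + 2 ^ n * (2 * x) := add_le_add h3 h4
      _ = _ := by ring

section CutKernel

variable {Ω U : Type*} [NormedAddCommGroup U] [NormedSpace ℝ U] {p q t : ℕ}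

/-- The integrand of the density of the values of the system, with variables
`(u, x, y)` in `Ω × ℝ^q × ℝ^t`. -/
def cutKernel (d : ℕ) (ν : Seminorm ℝ ((Fin p → ℝ) × (Fin q → ℝ) × (Fin t → ℝ) × U))
    (φ : Ω → Fin p → ℝ) (b : (Fin t → ℝ) → ℝ) (e : U) (R : ℝ)
    (z : Ω × (Fin q → ℝ) × (Fin t → ℝ)) : ENNReal :=
  if ν (posRpow ((d : ℝ)⁻¹) (b z.2.2 + powSum d z.2.1) • φ z.1, z.2.1, z.2.2, e) ≤ R then
    ENNReal.ofReal (posRpow ((p : ℝ) / d - 1) (b z.2.2 + powSum d z.2.1)) else 0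

variable {d : ℕ} {ν : Seminorm ℝ ((Fin p → ℝ) × (Fin q → ℝ) × (Fin t → ℝ) × U)}
  {φ : Ω → Fin p → ℝ}

lemma continuous_of_le_mul_norm {E : Type*} [NormedAddCommGroup E] [NormedSpace ℝ E]
    {ν : Seminorm ℝ E} {L : ℝ} (h : ∀ v, ν v ≤ L * ‖v‖) : Continuous ν :=
  Seminorm.continuous_of_le (q := (Real.toNNReal L) • normSeminorm ℝ E)
    (by
      simp only [FunLike.coe_smul]
      exact continuous_const.smul continuous_norm)
    fun v => (h v).trans (by
      simp only [smul_apply, coe_normSeminorm, NNReal.smul_def, smul_eq_mul]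
      gcongr
      exact Real.le_coe_toNNReal L)

lemma measurable_cutKernel_param [MeasurableSpace Ω] [MeasurableSpace U] [BorelSpace U]
    [SecondCountableTopology U]
    (hν : Continuous ν) (hφ : Measurable φ) {Λ : Type*} [MeasurableSpace Λ]
    {b : Λ → (Fin t → ℝ) → ℝ} {e : Λ → U} (hb : Measurable fun z : Λ × (Fin t → ℝ) => b z.1 z.2)
    (he : Measurable e) (R : ℝ) :
    Measurable fun z : Λ × (Ω × (Fin q → ℝ) × (Fin t → ℝ)) =>
      cutKernel d ν φ (b z.1) (e z.1) R z.2 := by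
  have hw : Measurable fun z : Λ × (Ω × (Fin q → ℝ) × (Fin t → ℝ)) =>
      b z.1 z.2.2.2 + powSum d z.2.2.1 := by
    refine Measurable.add ?_ (by fun_prop)
    exact hb.comp (measurable_fst.prodMk (by fun_prop))
  unfold cutKernel
  refine Measurable.ite (measurableSet_le ?_ measurable_const) (by fun_prop) measurable_const
  refine hν.measurable.comp ?_
  fun_prop

lemma measurable_cutKernel [MeasurableSpace Ω] [MeasurableSpace U] [BorelSpace U]
    [SecondCountableTopology U] (hν : Continuous ν) (hφ : Measurable φ)
    {b : (Fin t → ℝ) → ℝ} (hb : Measurable b) (e : U) (R : ℝ) :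
    Measurable (cutKernel d ν φ b e R) :=
  (measurable_cutKernel_param hν hφ (Λ := Unit) (b := fun _ => b) (e := fun _ => e)
    (by fun_prop) (by fun_prop) R).comp (measurable_const (a := ()).prodMk measurable_id)

/-- Substituting (T x, T y) gives T^(q+t). Since w scales by T^d, the kernel w^(p/d-1) gives
T^(p-d), while w^(1/d) scales by T, so the homogeneous cutoff returns to radius 1. -/
lemma lintegral_cutKernel_scale [MeasurableSpace Ω] [MeasurableSpace U] [BorelSpace U]
    [SecondCountableTopology U] (μ : Measure Ω) [SFinite μ] (hd : 0 < d) (hpq : d ≤ p + q)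
    (hν : Continuous ν) (hφ : Measurable φ)
    {b : (Fin t → ℝ) → ℝ} (hb : Measurable b) (e : U) {T : ℝ} (hT : 0 < T) :
    ∫⁻ z, cutKernel d ν φ b e T z ∂(μ.prod volume) = ENNReal.ofReal (T ^ (p + q - d + t)) *
      ∫⁻ z, cutKernel d ν φ (fun y => b (T • y) / T ^ d) (T⁻¹ • e) 1 z ∂(μ.prod volume) := by
  have hd0 : (0 : ℝ) < d := by exact_mod_cast hd
  have hHaar : (volume : Measure ((Fin q → ℝ) × (Fin t → ℝ))).IsAddHaarMeasure :=
    Measure.prod.instIsAddHaarMeasure volume volume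
  rw [lintegral_prod _ (measurable_cutKernel hν hφ hb e T).aemeasurable,
    lintegral_prod _ (measurable_cutKernel hν hφ (by fun_prop) _ 1).aemeasurable,
    ← lintegral_const_mul' _ _ ENNReal.ofReal_ne_top]
  refine lintegral_congr fun u => ?_
  rw [lintegral_smul_eq _ hT, Module.finrank_prod, Module.finrank_fin_fun, Module.finrank_fin_fun,
    ← lintegral_const_mul' _ _ ENNReal.ofReal_ne_top,
    ← lintegral_const_mul' _ _ ENNReal.ofReal_ne_top]
  refine lintegral_congr fun z => ?_
  have hw : b (T • z.2) + powSum d (T • z.1) =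
      T ^ d * (b (T • z.2) / T ^ d + powSum d z.1) := by
    rw [powSum_smul]; field_simp
  have hTd : (0 : ℝ) < T ^ d := by positivity
  unfold cutKernel
  simp only [Prod.smul_fst, Prod.smul_snd]
  have hp1 : (T ^ d) ^ ((p : ℝ) / d - 1) = T ^ ((d : ℝ) * ((p : ℝ) / d - 1)) := by
    rw [← Real.rpow_natCast, ← Real.rpow_mul hT.le]
  rw [hw, posRpow_mul hTd, posRpow_mul hTd, Real.pow_rpow_inv_natCast hT.le hd.ne', hp1]
  set w := b (T • z.2) / T ^ d + powSum d z.1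
  have hν1 : ν ((T * posRpow ((d : ℝ)⁻¹) w) • φ u, T • z.1, T • z.2, e) =
      T * ν (posRpow ((d : ℝ)⁻¹) w • φ u, z.1, z.2, T⁻¹ • e) := by
    have : ((T * posRpow ((d : ℝ)⁻¹) w) • φ u, T • z.1, T • z.2, e) =
      T • (posRpow ((d : ℝ)⁻¹) w • φ u, z.1, z.2, T⁻¹ • e) := by
      simp [mul_smul, hT.ne']
    rw [this, map_smul_eq_mul, Real.norm_of_nonneg hT.le]
  have hiff : T * ν (posRpow ((d : ℝ)⁻¹) w • φ u, z.1, z.2, T⁻¹ • e) ≤ T ↔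
      ν (posRpow ((d : ℝ)⁻¹) w • φ u, z.1, z.2, T⁻¹ • e) ≤ 1 := by
    conv_lhs => rhs; rw [← mul_one T]
    exact mul_le_mul_iff_right₀ hT
  rw [hν1]
  simp only [hiff, mul_ite, mul_zero]
  split_ifs
  · rw [← ENNReal.ofReal_mul (by positivity), ← ENNReal.ofReal_mul (by positivity), ← mul_assoc]
    congr 2
    rw [← Real.rpow_natCast, ← Real.rpow_natCast, ← Real.rpow_add hT]
    congr 1
    rw [Nat.cast_add, Nat.cast_add, Nat.cast_sub hpq]
    push_cast
    field_simp
    ring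
  · rfl

end CutKernel

/-! ### Comparison of a small level with level zero -/

section Estimate

variable {Ω U : Type*} [NormedAddCommGroup U] [NormedSpace ℝ U] {p q t : ℕ} {d : ℕ}
  {ν : Seminorm ℝ ((Fin p → ℝ) × (Fin q → ℝ) × (Fin t → ℝ) × U)} {φ : Ω → Fin p → ℝ}

/-- Errors that see x only through W = `powSum d x` reduce to one-dimensional integrals in W,
uniformly over the bounded set of y. -/
lemma lintegral_fiber_le [MeasurableSpace Ω] (μ : Measure Ω) [SFinite μ]
    {c : ℝ} {γ : ℝ} (hc : ∀ g : ℝ → ENNReal, Measurable g →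
      ∫⁻ x : Fin q → ℝ, g (powSum d x) = ENNReal.ofReal c *
        ∫⁻ W in Set.Ioi (0 : ℝ), g W * ENNReal.ofReal (W ^ γ))
    {g : (Fin t → ℝ) → ℝ → ENNReal} (hg : Measurable fun z : (Fin t → ℝ) × ℝ => g z.1 z.2)
    {K : ENNReal} {L : ℝ} (hK : ∀ y : Fin t → ℝ, ‖y‖ ≤ L →
      ∫⁻ W in Set.Ioi (0 : ℝ), g y W * ENNReal.ofReal (W ^ γ) ≤ K) :
    ∫⁻ z : Ω × (Fin q → ℝ) × (Fin t → ℝ),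
        (if ‖z.2.2‖ ≤ L then g z.2.2 (powSum d z.2.1) else 0) ∂(μ.prod volume) ≤
      μ Set.univ * (ENNReal.ofReal c * K * volume (Metric.closedBall (0 : Fin t → ℝ) L)) := by
  have hm1 : Measurable fun z : (Fin q → ℝ) × (Fin t → ℝ) =>
      if ‖z.2‖ ≤ L then g z.2 (powSum d z.1) else 0 := by
    refine Measurable.ite (measurableSet_le (by fun_prop) measurable_const) ?_ measurable_const
    exact hg.comp (measurable_snd.prodMk (measurable_powSum.comp measurable_fst))
  have hm2 : Measurable fun z : Ω × (Fin q → ℝ) × (Fin t → ℝ) =>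
      if ‖z.2.2‖ ≤ L then g z.2.2 (powSum d z.2.1) else 0 := hm1.comp measurable_snd
  rw [lintegral_prod _ hm2.aemeasurable]
  simp only
  rw [lintegral_const, mul_comm]
  gcongr
  rw [Measure.volume_eq_prod, lintegral_prod_symm _ hm1.aemeasurable]
  calc ∫⁻ y : Fin t → ℝ, ∫⁻ x : Fin q → ℝ, (if ‖y‖ ≤ L then g y (powSum d x) else 0)
      ≤ ∫⁻ y : Fin t → ℝ, (Metric.closedBall (0 : Fin t → ℝ) L).indicator
          (fun _ => ENNReal.ofReal c * K) y := by
        refine lintegral_mono fun y => ?_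
        by_cases hy : ‖y‖ ≤ L
        · rw [Set.indicator_of_mem (by simpa using hy)]
          simp only [hy, if_true]
          rw [hc (g y) (hg.comp (measurable_const.prodMk measurable_id))]
          gcongr
          exact hK y hy
        · simp [hy]
    _ = _ := by
        rw [lintegral_indicator Metric.isClosed_closedBall.measurableSet, setLIntegral_const]

lemma norm_le_of_cut {L R : ℝ} (hL : 0 ≤ L) (h2 : ∀ v, ‖v‖ ≤ L * ν v) {x₁ : Fin p → ℝ}
    {x : Fin q → ℝ} {y : Fin t → ℝ} {e : U} (h : ν (x₁, x, y, e) ≤ R) :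
    ‖x₁‖ ≤ L * R ∧ ‖x‖ ≤ L * R ∧ ‖y‖ ≤ L * R ∧ ‖e‖ ≤ L * R := by
  have h3 := (h2 (x₁, x, y, e)).trans (mul_le_mul_of_nonneg_left h hL)
  simp only [Prod.norm_def, sup_le_iff] at h3
  exact h3

/-- The triangle inequality: the two points differ only in the radial factor and in the last block.
-/
lemma abs_seminorm_sub_le {L Rφ κ κ₀ Δ : ℝ} (hL : 0 ≤ L) (h1 : ∀ v, ν v ≤ L * ‖v‖)
    {f : Fin p → ℝ} (hf : ‖f‖ ≤ Rφ)
    (x : Fin q → ℝ) (y : Fin t → ℝ) (e : U) (hΔ : L * (|κ - κ₀| * Rφ + ‖e‖) ≤ Δ) :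
    ν (κ • f, x, y, e) ≤ ν (κ₀ • f, x, y, 0) + Δ ∧
      ν (κ₀ • f, x, y, 0) ≤ ν (κ • f, x, y, e) + Δ := by
  have h3 : (κ • f, x, y, e) - (κ₀ • f, x, y, (0 : U)) = ((κ - κ₀) • f, 0, 0, e) := by
    simp [sub_smul]
  have h4 : ν ((κ • f, x, y, e) - (κ₀ • f, x, y, (0 : U))) ≤ Δ := by
    rw [h3]
    refine (h1 _).trans (le_trans ?_ hΔ)
    gcongr
    simp only [Prod.norm_def, sup_le_iff, norm_zero]
    have a1 : ‖(κ - κ₀) • f‖ ≤ |κ - κ₀| * Rφ := by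
      rw [norm_smul, Real.norm_eq_abs]; gcongr
    have a2 := norm_nonneg e
    have a3 := (norm_nonneg ((κ - κ₀) • f)).trans a1
    exact ⟨by linarith, by linarith, by linarith, by linarith⟩
  have h6 := abs_sub_map_le_sub ν (κ • f, x, y, e) (κ₀ • f, x, y, (0 : U))
  have h7 := abs_le.1 (h6.trans h4)
  exact ⟨by linarith [h7.2], by linarith [h7.1]⟩

/-- The part of the integrand at level zero that lies in a thin shell about the unit sphere. -/
def shellKernel (d : ℕ) (ν : Seminorm ℝ ((Fin p → ℝ) × (Fin q → ℝ) × (Fin t → ℝ) × U))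
    (φ : Ω → Fin p → ℝ) (Δ : ℝ) (z : Ω × (Fin q → ℝ) × (Fin t → ℝ)) : ENNReal :=
  cutKernel d ν φ 0 0 (1 + Δ) z - cutKernel d ν φ 0 0 (1 - Δ) z

lemma cutKernel_eq_of_le {b : (Fin t → ℝ) → ℝ} {e : U} {R : ℝ} {z : Ω × (Fin q → ℝ) × (Fin t → ℝ)}
    (h : ν (posRpow ((d : ℝ)⁻¹) (b z.2.2 + powSum d z.2.1) • φ z.1, z.2.1, z.2.2, e) ≤ R) :
    cutKernel d ν φ b e R z = ENNReal.ofReal (posRpow ((p : ℝ) / d - 1)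
      (b z.2.2 + powSum d z.2.1)) := if_pos h

lemma cutKernel_eq_of_lt {b : (Fin t → ℝ) → ℝ} {e : U} {R : ℝ} {z : Ω × (Fin q → ℝ) × (Fin t → ℝ)}
    (h : R < ν (posRpow ((d : ℝ)⁻¹) (b z.2.2 + powSum d z.2.1) • φ z.1, z.2.1, z.2.2, e)) :
    cutKernel d ν φ b e R z = 0 := if_neg h.not_ge

/-- The pointwise comparison between the integrands at a level `b` and at level zero. -/
lemma cutKernel_compare (hde : Even d) {L Rφ C₁ C₂ B D Δ : ℝ} (hL : 0 ≤ L) (hRφ : 0 ≤ Rφ)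
    (h1 : ∀ v, ν v ≤ L * ‖v‖) (h2 : ∀ v, ‖v‖ ≤ L * ν v) (hφ : ∀ u, ‖φ u‖ ≤ Rφ)
    (hC₁ : ∀ b W : ℝ, 0 < W → |b| ≤ W / 2 → |(b + W) ^ ((p : ℝ) / d - 1) - W ^ ((p : ℝ) / d - 1)| ≤
      C₁ * |b| * W ^ ((p : ℝ) / d - 1 - 1))
    (hC₂ : ∀ b W : ℝ, 0 < W → |b| ≤ W / 2 → |(b + W) ^ ((d : ℝ)⁻¹) - W ^ ((d : ℝ)⁻¹)| ≤
      C₂ * |b| * W ^ ((d : ℝ)⁻¹ - 1))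
    (hC₁0 : 0 ≤ C₁) (hC₂0 : 0 ≤ C₂) (hd1 : (d : ℝ)⁻¹ ≤ 1)
    (hD : 0 < D) (hB0 : 0 ≤ B) (hB : 2 * B ≤ D) {b : (Fin t → ℝ) → ℝ}
    (hb : ∀ y, ‖y‖ ≤ L → |b y| ≤ B)
    {e : U} (hΔ : L * (C₂ * B * D ^ ((d : ℝ)⁻¹ - 1) * Rφ + ‖e‖) ≤ Δ)
    (z : Ω × (Fin q → ℝ) × (Fin t → ℝ)) :
    cutKernel d ν φ b e 1 z ≤ cutKernel d ν φ 0 0 1 z + (if ‖z.2.2‖ ≤ L then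
        kernelError ((p : ℝ) / d - 1) C₁ D B (q * L ^ d) (b z.2.2) (powSum d z.2.1) else 0) +
        shellKernel d ν φ Δ z ∧
    cutKernel d ν φ 0 0 1 z ≤ cutKernel d ν φ b e 1 z + (if ‖z.2.2‖ ≤ L then
        kernelError ((p : ℝ) / d - 1) C₁ D B (q * L ^ d) (b z.2.2) (powSum d z.2.1) else 0) +
        shellKernel d ν φ Δ z := by
  obtain ⟨u, x, y⟩ := z
  set α : ℝ := (p : ℝ) / d - 1
  set W := powSum d x with hW
  -- If x or y leaves the ball of radius L, the cutoff kills both kernels.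
  by_cases hcut : ‖x‖ ≤ L ∧ ‖y‖ ≤ L
  swap
  · have e1 : ∀ (b : (Fin t → ℝ) → ℝ) (e : U), cutKernel d ν φ b e 1 (u, x, y) = 0 := by
      intro b e
      apply cutKernel_eq_of_lt
      by_contra h
      have := norm_le_of_cut hL h2 (not_lt.1 h)
      rw [mul_one] at this
      exact hcut ⟨this.2.1, this.2.2.1⟩
    rw [e1, e1]
    exact ⟨zero_le, zero_le⟩
  obtain ⟨hx, hy⟩ := hcut
  simp only [hy, if_true]
  have hWM : W ≤ q * L ^ d := by simpa using powSum_le hde hx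
  have hle : ∀ (b : (Fin t → ℝ) → ℝ) (e : U), cutKernel d ν φ b e 1 (u, x, y) ≤
      ENNReal.ofReal (posRpow α (b y + W)) := by
    intro b e
    unfold cutKernel
    split_ifs
    · exact le_rfl
    · exact zero_le
  -- Below D there may be no cancellation to exploit, so each kernel is charged to the error. From D
  -- on, |b| ≤ B ≤ W/2 and first-order bounds apply.
  rcases lt_or_ge W D with hWD | hWD
  · have hE : kernelError α C₁ D B (q * L ^ d) (b y) W =
      ENNReal.ofReal (posRpow α (b y + W)) + ENNReal.ofReal (posRpow α W) := if_pos hWD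
    rw [hE]
    constructor
    · refine (hle b e).trans ?_
      refine le_trans ?_ le_self_add
      refine le_trans ?_ le_add_self
      exact le_self_add
    · refine (hle 0 0).trans ?_
      simp only [Pi.zero_apply, zero_add]
      refine le_trans ?_ le_self_add
      refine le_trans ?_ le_add_self
      exact le_add_self
  · have hW0 : 0 < W := hD.trans_le hWD
    have hE : kernelError α C₁ D B (q * L ^ d) (b y) W = ENNReal.ofReal (C₁ * B * W ^ (α - 1)) := by
      unfold kernelError
      rw [if_neg hWD.not_gt, if_pos hWM]
    rw [hE]
    have hby := hb y hy
    have hby' := abs_le.1 hby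
    have hbW : |b y| ≤ W / 2 := by linarith
    have hbW0 : 0 < b y + W := by linarith
    have k1 : |posRpow α (b y + W) - posRpow α W| ≤ C₁ * B * W ^ (α - 1) := by
      rw [posRpow_of_pos _ hbW0, posRpow_of_pos _ hW0]
      exact (hC₁ _ _ hW0 hbW).trans (by gcongr)
    have k2 : |posRpow ((d : ℝ)⁻¹) (b y + W) - posRpow ((d : ℝ)⁻¹) W| ≤
        C₂ * B * D ^ ((d : ℝ)⁻¹ - 1) := by
      rw [posRpow_of_pos _ hbW0, posRpow_of_pos _ hW0]
      refine (hC₂ _ _ hW0 hbW).trans ?_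
      have : W ^ ((d : ℝ)⁻¹ - 1) ≤ D ^ ((d : ℝ)⁻¹ - 1) :=
        Real.rpow_le_rpow_of_nonpos hD hWD (by linarith)
      gcongr
    obtain ⟨n1, n2⟩ := abs_seminorm_sub_le (ν := ν) (κ := posRpow ((d : ℝ)⁻¹) (b y + W))
      (κ₀ := posRpow ((d : ℝ)⁻¹) W) (Δ := Δ) hL h1 (hφ u) x y e
      (le_trans (by gcongr) hΔ)
    have hk1 := abs_le.1 k1
    have kk1 : ENNReal.ofReal (posRpow α (b y + W)) ≤
        ENNReal.ofReal (posRpow α W) + ENNReal.ofReal (C₁ * B * W ^ (α - 1)) := by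
      rw [← ENNReal.ofReal_add (posRpow_nonneg _ _) (by positivity)]
      exact ENNReal.ofReal_le_ofReal (by linarith)
    have kk2 : ENNReal.ofReal (posRpow α W) ≤
        ENNReal.ofReal (posRpow α (b y + W)) + ENNReal.ofReal (C₁ * B * W ^ (α - 1)) := by
      rw [← ENNReal.ofReal_add (posRpow_nonneg _ _) (by positivity)]
      exact ENNReal.ofReal_le_ofReal (by linarith)
    set Nb := ν (posRpow ((d : ℝ)⁻¹) (b y + W) • φ u, x, y, e) with hNb
    set N0 := ν (posRpow ((d : ℝ)⁻¹) W • φ u, x, y, (0 : U)) with hN0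
    have c0 : ∀ R, N0 ≤ R → cutKernel d ν φ 0 0 R (u, x, y) = ENNReal.ofReal (posRpow α W) := by
      intro R hR
      rw [cutKernel_eq_of_le] <;> simp only [Pi.zero_apply, zero_add]
      · rfl
      · exact hR
    have c0' : ∀ R, R < N0 → cutKernel d ν φ 0 0 R (u, x, y) = 0 := by
      intro R hR
      apply cutKernel_eq_of_lt
      simp only [Pi.zero_apply, zero_add]
      exact hR
    have cb : ∀ R, Nb ≤ R → cutKernel d ν φ b e R (u, x, y) =
      ENNReal.ofReal (posRpow α (b y + W)) := fun R hR => cutKernel_eq_of_le hR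
    have cb' : ∀ R, R < Nb → cutKernel d ν φ b e R (u, x, y) = 0 := fun R hR =>
      cutKernel_eq_of_lt hR
    constructor
    · rcases lt_or_ge 1 Nb with hb1 | hb1
      · rw [cb' 1 hb1]; exact zero_le
      rw [cb 1 hb1]
      rcases lt_or_ge 1 N0 with h01 | h01
      -- The cutoffs disagree, while `N0` and `Nb` differ by at most Δ. Hence `N0` lies in the shell
      -- about 1, where `shellKernel` is the whole level-zero kernel.
      · have hs : shellKernel d ν φ Δ (u, x, y) = ENNReal.ofReal (posRpow α W) := by
          rw [shellKernel, c0 _ (by linarith), c0' (1 - Δ) (by linarith), tsub_zero]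
        rw [c0' 1 h01, hs, zero_add]
        exact kk1.trans (add_comm _ _).le
      · rw [c0 1 h01]
        exact kk1.trans le_self_add
    · rcases lt_or_ge 1 N0 with h01 | h01
      · rw [c0' 1 h01]; exact zero_le
      rw [c0 1 h01]
      rcases lt_or_ge 1 Nb with hb1 | hb1
      · have hs : shellKernel d ν φ Δ (u, x, y) = ENNReal.ofReal (posRpow α W) := by
          rw [shellKernel, c0 _ (by linarith), c0' (1 - Δ) (by linarith), tsub_zero]
        rw [hs]
        exact le_add_self
      · rw [cb 1 hb1]
        exact kk2.trans le_self_add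

end Estimate

section Estimate

variable {Ω U : Type*} [NormedAddCommGroup U] [NormedSpace ℝ U] {p q t : ℕ} {d : ℕ}
  {ν : Seminorm ℝ ((Fin p → ℝ) × (Fin q → ℝ) × (Fin t → ℝ) × U)} {φ : Ω → Fin p → ℝ}
  [MeasurableSpace Ω]

/-- After integrating out the bounded variables, the kernel is W^((p+q)/d-2) on a bounded interval,
integrable because p + q > d. -/
lemma lintegral_cutKernel_zero_lt_top (μ : Measure Ω) [IsFiniteMeasure μ] (hd : 2 ≤ d)
    (hde : Even d) (hp : 1 ≤ p) (hq : 1 ≤ q)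
    (hpq : d + 1 ≤ p + q) {L : ℝ} (hL : 0 ≤ L) (h2 : ∀ v, ‖v‖ ≤ L * ν v) :
    ∫⁻ z, cutKernel d ν φ 0 0 1 z ∂(μ.prod volume) < ⊤ := by
  have hd0 : (0 : ℝ) < d := by exact_mod_cast (by omega : 0 < d)
  have hp0 : (1 : ℝ) ≤ p := by exact_mod_cast hp
  have hq0 : (1 : ℝ) ≤ q := by exact_mod_cast hq
  have hm : (d : ℝ) + 1 ≤ p + q := by exact_mod_cast hpq
  set α : ℝ := (p : ℝ) / d - 1 with hα
  set γ : ℝ := (q : ℝ) / d - 1 with hγ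
  have hα1 : -1 < α := by
    have : (0 : ℝ) < p / d := by positivity
    linarith
  have hγ1 : -1 < γ := by
    have : (0 : ℝ) < q / d := by positivity
    linarith
  have hαγ1 : -1 < α + γ := by
    have : (0 : ℝ) < ((p : ℝ) + q - d) / d := div_pos (by linarith) hd0
    have hαγ : α + γ + 1 = ((p : ℝ) + q - d) / d := by rw [hα, hγ]; field_simp; ring
    linarith
  obtain ⟨C, -, hC⟩ := exists_lintegral_posRpow_mul_le hα1 hγ1 hαγ1
  obtain ⟨c, -, hc⟩ := exists_lintegral_powSum (by omega : 0 < d) hde hq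
  set M : ℝ := q * L ^ d + 1 with hM
  have hM0 : 0 < M := by positivity
  have hcM := hC 0 M hM0 (by simpa using hM0.le)
  set g : (Fin t → ℝ) → ℝ → ENNReal := fun _ W =>
    if W < M then ENNReal.ofReal (posRpow α (0 + W)) else 0 with hg
  have hgm : Measurable fun z : (Fin t → ℝ) × ℝ => g z.1 z.2 :=
    Measurable.ite (measurableSet_lt measurable_snd measurable_const) (by fun_prop)
      measurable_const
  have hsplit : Set.Ioi (0 : ℝ) = Set.Ioo 0 M ∪ Set.Ici M := by
    rw [Set.Ioo_union_Ici_eq_Ioi hM0]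
  have hK : ∀ y : Fin t → ℝ, ‖y‖ ≤ L → ∫⁻ W in Set.Ioi (0 : ℝ), g y W * ENNReal.ofReal (W ^ γ) ≤
      ENNReal.ofReal (C * M ^ (α + γ + 1)) + 0 := by
    intro y _
    rw [hsplit]
    refine (lintegral_union_le _ _ _).trans (add_le_add (le_trans ?_ hcM) ?_)
    · refine setLIntegral_mono' measurableSet_Ioo fun W hW => ?_
      simp only [hg, hW.2, if_true]
      exact le_rfl
    · rw [nonpos_iff_eq_zero]
      rw [setLIntegral_congr_fun (g := fun _ => 0) measurableSet_Ici]
      · simp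
      · intro W hW
        have hW : M ≤ W := hW
        simp [hg, hW.not_gt]
  refine lt_of_le_of_lt (lintegral_mono fun z => ?_)
    (lt_of_le_of_lt (lintegral_fiber_le μ hc hgm hK) ?_)
  · unfold cutKernel
    split_ifs with h h' h'
    · have hn := norm_le_of_cut hL h2 h
      rw [mul_one] at hn
      have hW : powSum d z.2.1 < M := by
        have := powSum_le hde hn.2.1
        simp only [Fintype.card_fin] at this
        linarith
      simp only [hg, hW, if_true, Pi.zero_apply]
      exact le_rfl
    · have hn := norm_le_of_cut hL h2 h
      rw [mul_one] at hn
      exact absurd hn.2.2.1 h'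
    · exact zero_le
    · exact le_rfl
  · rw [add_zero]
    exact ENNReal.mul_lt_top (measure_lt_top _ _) (ENNReal.mul_lt_top
      (ENNReal.mul_lt_top ENNReal.ofReal_lt_top ENNReal.ofReal_lt_top)
      measure_closedBall_lt_top)

variable [MeasurableSpace U] [BorelSpace U] [SecondCountableTopology U]

lemma lintegral_cutKernel_zero (μ : Measure Ω) [SFinite μ] (hd : 0 < d)
    (hpq : d ≤ p + q) (hν : Continuous ν) (hφ : Measurable φ) {R : ℝ} (hR : 0 < R) :
    ∫⁻ z, cutKernel d ν φ 0 0 R z ∂(μ.prod volume) = ENNReal.ofReal (R ^ (p + q - d + t)) *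
      ∫⁻ z, cutKernel d ν φ 0 0 1 z ∂(μ.prod volume) := by
  rw [lintegral_cutKernel_scale μ hd hpq hν hφ (b := 0) measurable_const 0 hR]
  simp only [Pi.zero_apply, zero_div, smul_zero]
  rfl

/-- Near the origin the cutoff is satisfied, and the kernel is positive wherever x ≠ 0. -/
lemma lintegral_cutKernel_zero_pos (μ : Measure Ω) [SFinite μ] (hμ : μ ≠ 0) (hd : 0 < d)
    (hde : Even d) (hq : 1 ≤ q) (hν : Continuous ν) (hφ : Measurable φ) {L Rφ : ℝ} (hL : 0 ≤ L)
    (h1 : ∀ v, ν v ≤ L * ‖v‖) (hRφ : 0 ≤ Rφ) (hφR : ∀ u, ‖φ u‖ ≤ Rφ) :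
    0 < ∫⁻ z, cutKernel d ν φ 0 0 1 z ∂(μ.prod volume) := by
  have hne : Nonempty (Fin q) := ⟨⟨0, hq⟩⟩
  rw [pos_iff_ne_zero, Ne, lintegral_eq_zero_iff (measurable_cutKernel hν hφ (b := 0) measurable_const 0 1)]
  intro h
  set k : ℝ := (q : ℝ) ^ ((d : ℝ)⁻¹) with hk
  have hk0 : 0 ≤ k := by positivity
  set r : ℝ := 1 / (L * (k * Rφ + 1) + 1) with hr
  have hr0 : 0 < r := by positivity
  have hr1 : L * (k * Rφ + 1) * r ≤ 1 := by
    rw [hr, mul_one_div, div_le_one (by positivity)]; linarith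
  set S : Set (Ω × (Fin q → ℝ) × (Fin t → ℝ)) :=
    Set.univ ×ˢ ((Metric.ball 0 r \ {0}) ×ˢ Metric.ball 0 r) with hS
  have hSpos : (μ.prod volume) S ≠ 0 := by
    rw [hS, Measure.prod_prod, Measure.volume_eq_prod, Measure.prod_prod]
    refine mul_ne_zero (by simpa using hμ) (mul_ne_zero ?_ (Metric.measure_ball_pos _ _ hr0).ne')
    -- Deleting the origin costs nothing since q ≥ 1.
    rw [measure_sdiff_null (measure_singleton _)]
    exact (Metric.measure_ball_pos _ _ hr0).ne'
  refine hSpos (measure_mono_null (fun z hz => ?_) h)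
  obtain ⟨-, ⟨hx, hx0⟩, hy⟩ := hz
  have hx : ‖z.2.1‖ < r := by simpa using hx
  have hy : ‖z.2.2‖ < r := by simpa using hy
  have hW : 0 < powSum d z.2.1 := powSum_pos hde hx0
  have hWr : powSum d z.2.1 ≤ q * r ^ d := by simpa using powSum_le hde hx.le
  have hκ : posRpow ((d : ℝ)⁻¹) (0 + powSum d z.2.1) ≤ k * r := by
    rw [zero_add, posRpow_of_pos _ hW]
    calc _ ≤ ((q : ℝ) * r ^ d) ^ ((d : ℝ)⁻¹) := by gcongr
      _ = _ := by
        rw [Real.mul_rpow (by positivity) (by positivity), Real.pow_rpow_inv_natCast hr0.le hd.ne']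
  have hcut : ν (posRpow ((d : ℝ)⁻¹) ((0 : (Fin t → ℝ) → ℝ) z.2.2 + powSum d z.2.1) • φ z.1,
      z.2.1, z.2.2, (0 : U)) ≤ 1 := by
    refine (h1 _).trans (le_trans ?_ hr1)
    rw [mul_assoc]
    gcongr
    have a1 : ‖posRpow ((d : ℝ)⁻¹) ((0 : (Fin t → ℝ) → ℝ) z.2.2 + powSum d z.2.1) • φ z.1‖ ≤
        k * r * Rφ := by
      rw [norm_smul, Real.norm_of_nonneg (posRpow_nonneg _ _)]
      exact mul_le_mul hκ (hφR _) (norm_nonneg _) (by positivity)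
    have a2 : 0 ≤ k * r * Rφ := by positivity
    simp only [Prod.norm_def, sup_le_iff, norm_zero]
    exact ⟨by linarith, by linarith, by linarith, by linarith⟩
  intro h0
  have h0 : cutKernel d ν φ 0 0 1 z = 0 := h0
  rw [cutKernel_eq_of_le hcut] at h0
  simp only [Pi.zero_apply, zero_add, ENNReal.ofReal_eq_zero] at h0
  rw [posRpow_of_pos _ hW] at h0
  exact absurd h0 (not_le.2 (by positivity))

/-- By homogeneity the mass within radius R is R^n times that at radius 1, so the shell has mass
proportional to (1+Δ)^n - (1-Δ)^n = O(Δ). -/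
lemma lintegral_shellKernel_le (μ : Measure Ω) [IsFiniteMeasure μ] (hd : 0 < d)
    (hpq : d ≤ p + q) (hν : Continuous ν) (hφ : Measurable φ)
    (hfin : ∫⁻ z, cutKernel d ν φ 0 0 1 z ∂(μ.prod volume) < ⊤) {Δ : ℝ} (hΔ : 0 ≤ Δ) (hΔ1 : Δ < 1) :
    ∫⁻ z, shellKernel d ν φ Δ z ∂(μ.prod volume) ≤
      ENNReal.ofReal ((p + q - d + t : ℕ) * 2 ^ (p + q - d + t) *
        (∫⁻ z, cutKernel d ν φ 0 0 1 z ∂(μ.prod volume)).toReal * Δ) := by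
  set n := p + q - d + t
  set c := ∫⁻ z, cutKernel d ν φ 0 0 1 z ∂(μ.prod volume) with hc
  have h0 := lintegral_cutKernel_zero (t := t) μ hd hpq hν hφ (R := 1 - Δ) (by linarith)
  have h1 := lintegral_cutKernel_zero (t := t) μ hd hpq hν hφ (R := 1 + Δ) (by linarith)
  unfold shellKernel
  rw [lintegral_sub (measurable_cutKernel hν hφ (b := 0) measurable_const 0 _), h0, h1]
  · change ENNReal.ofReal ((1 + Δ) ^ n) * c - ENNReal.ofReal ((1 - Δ) ^ n) * c ≤ _
    rw [← ENNReal.ofReal_toReal hfin.ne, ← ENNReal.ofReal_mul (by positivity),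
      ← ENNReal.ofReal_mul (pow_nonneg (by linarith) n), ← ENNReal.ofReal_sub _
        (mul_nonneg (pow_nonneg (by linarith) n) ENNReal.toReal_nonneg),
      ENNReal.toReal_ofReal ENNReal.toReal_nonneg]
    apply ENNReal.ofReal_le_ofReal
    have := mul_le_mul_of_nonneg_right (one_add_pow_sub_le n hΔ hΔ1.le)
      (ENNReal.toReal_nonneg (a := c))
    linarith
  · rw [h0]
    exact (ENNReal.mul_lt_top ENNReal.ofReal_lt_top hfin).ne
  · refine Eventually.of_forall fun z => ?_
    unfold cutKernel
    split_ifs with h h'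
    · exact le_rfl
    · exact absurd (h.trans (by linarith)) h'
    · exact zero_le
    · exact le_rfl

/-- The comparison between the density at a level of size at most `B`, with the bounded
coordinates of size at most `ε`, and the density at level zero. -/
theorem exists_cutKernel_estimate (μ : Measure Ω) [IsFiniteMeasure μ] (hd : 2 ≤ d)
    (hde : Even d) (hp : 1 ≤ p) (hq : 1 ≤ q)
    (hpq : d + 1 ≤ p + q) (hφ : Measurable φ) {L Rφ : ℝ} (hL : 0 ≤ L) (hRφ : 0 ≤ Rφ)
    (h1 : ∀ v, ν v ≤ L * ‖v‖) (h2 : ∀ v, ‖v‖ ≤ L * ν v) (hφR : ∀ u, ‖φ u‖ ≤ Rφ) :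
    ∃ C : ℝ, 0 < C ∧ ∃ η : ℝ, 0 < η ∧ ∀ (b : (Fin t → ℝ) → ℝ) (e : U) (B ε : ℝ),
      Measurable b → 0 < B → 0 ≤ ε → ε + B ^ (((p : ℝ) + q - d) / (p + q - 1)) ≤ η →
      (∀ y, ‖y‖ ≤ L → |b y| ≤ B) → ‖e‖ ≤ ε →
      ∫⁻ z, cutKernel d ν φ b e 1 z ∂(μ.prod volume) ≤
        ∫⁻ z, cutKernel d ν φ 0 0 1 z ∂(μ.prod volume) +
          ENNReal.ofReal (C * (ε + B ^ (((p : ℝ) + q - d) / (p + q - 1)))) ∧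
      ∫⁻ z, cutKernel d ν φ 0 0 1 z ∂(μ.prod volume) ≤
        ∫⁻ z, cutKernel d ν φ b e 1 z ∂(μ.prod volume) +
          ENNReal.ofReal (C * (ε + B ^ (((p : ℝ) + q - d) / (p + q - 1)))) := by
  have hdN : 0 < d := by omega
  have hd0 : (2 : ℝ) ≤ d := by exact_mod_cast hd
  have hm : (d : ℝ) + 1 ≤ p + q := by exact_mod_cast hpq
  have hm1 : (0 : ℝ) < (p : ℝ) + q - 1 := by linarith
  have hν := continuous_of_le_mul_norm h1
  set θ : ℝ := ((p : ℝ) + q - d) / (p + q - 1) with hθ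
  have hθ0 : 0 < θ := div_pos (by linarith) hm1
  obtain ⟨C₁, hC₁0, hC₁⟩ := exists_abs_rpow_add_sub_le ((p : ℝ) / d - 1)
  obtain ⟨C₂, hC₂0, hC₂⟩ := exists_abs_rpow_add_sub_le ((d : ℝ)⁻¹)
  obtain ⟨C₃, hC₃0, hC₃⟩ := exists_lintegral_kernelError_le hd hp hq hpq hC₁0
    (M := q * L ^ d) (by positivity)
  obtain ⟨c, hc0, hc⟩ := exists_lintegral_powSum hdN hde hq
  have hfin : ∫⁻ z, cutKernel d ν φ 0 0 1 z ∂(μ.prod volume) < ⊤ :=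
    lintegral_cutKernel_zero_lt_top μ hd hde hp hq hpq hL h2
  set c0 : ℝ := (∫⁻ z, cutKernel d ν φ 0 0 1 z ∂(μ.prod volume)).toReal with hc0
  have hc00 : 0 ≤ c0 := ENNReal.toReal_nonneg
  set n := p + q - d + t with hn
  set vol : ℝ := (volume (Metric.closedBall (0 : Fin t → ℝ) L)).toReal with hvol
  have hvol' : volume (Metric.closedBall (0 : Fin t → ℝ) L) = ENNReal.ofReal vol :=
    (ENNReal.ofReal_toReal measure_closedBall_lt_top.ne).symm
  have hvol0 : 0 ≤ vol := ENNReal.toReal_nonneg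
  set m0 : ℝ := μ.real Set.univ with hm0
  have hm0' : μ Set.univ = ENNReal.ofReal m0 := (ofReal_measureReal (measure_ne_top _ _)).symm
  have hm00 : 0 ≤ m0 := measureReal_nonneg
  set Q : ℝ := L * (C₂ * Rφ + 1) with hQ
  have hQ0 : 0 ≤ Q := by positivity
  -- The constant adds the kernel error to the shell error at width Δ = Q (ε + B^θ). The bound η =
  -- 1/(Q+1) ensures Δ < 1 and also ε + B^θ ≤ 1, hence B ≤ 1.
  refine ⟨m0 * (c * C₃ * vol) + n * 2 ^ n * c0 * Q + 1, by positivity, 1 / (Q + 1),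
    by positivity, fun b e B ε hbm hB hε hη hb he => ?_⟩
  have hBθ : 0 < B ^ θ := by positivity
  have hη1 : ε + B ^ θ ≤ 1 := hη.trans (by rw [div_le_one (by positivity)]; linarith)
  have hB1 : B ≤ 1 := by
    by_contra h
    have := Real.one_lt_rpow (not_le.1 h) hθ0
    linarith
  set D : ℝ := 2 * B ^ ((d : ℝ) / (p + q - 1)) with hD
  have hD0 : 0 < D := by positivity
  have hBD : 2 * B ≤ D := by
    have : B ≤ B ^ ((d : ℝ) / (p + q - 1)) := by
      conv_lhs => rw [← Real.rpow_one B]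
      exact Real.rpow_le_rpow_of_exponent_ge hB hB1 (by rw [div_le_one hm1]; linarith)
    linarith
  have hd1 : (d : ℝ)⁻¹ ≤ 1 := inv_le_one_of_one_le₀ (by linarith)
  set Δ : ℝ := Q * (ε + B ^ θ) with hΔdef
  have hΔ0 : 0 ≤ Δ := by positivity
  have hΔ1 : Δ < 1 := by
    calc Q * (ε + B ^ θ) ≤ Q * (1 / (Q + 1)) := by gcongr
      _ < 1 := by rw [mul_one_div, div_lt_one (by positivity)]; linarith
  -- The shell width at the threshold: 1 + (1-d)/(p+q-1) = θ.
  have hBDθ : B * D ^ ((d : ℝ)⁻¹ - 1) ≤ B ^ θ := by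
    have e2 : (2 : ℝ) ^ ((d : ℝ)⁻¹ - 1) ≤ 1 :=
      Real.rpow_le_one_of_one_le_of_nonpos (by norm_num) (by linarith)
    have e3 : B * (B ^ ((d : ℝ) / (p + q - 1))) ^ ((d : ℝ)⁻¹ - 1) = B ^ θ := by
      rw [← Real.rpow_mul hB.le]
      nth_rewrite 1 [← Real.rpow_one B]
      rw [← Real.rpow_add hB]
      congr 1
      rw [hθ]
      field_simp
      ring
    rw [hD, Real.mul_rpow (by norm_num) (by positivity), mul_left_comm, e3]
    calc _ ≤ 1 * B ^ θ := by gcongr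
      _ = _ := one_mul _
  have hΔle : L * (C₂ * B * D ^ ((d : ℝ)⁻¹ - 1) * Rφ + ‖e‖) ≤ Δ := by
    rw [hΔdef, hQ, mul_assoc L]
    gcongr
    have a1 : C₂ * B * D ^ ((d : ℝ)⁻¹ - 1) * Rφ ≤ C₂ * Rφ * B ^ θ := by
      calc _ = C₂ * Rφ * (B * D ^ ((d : ℝ)⁻¹ - 1)) := by ring
        _ ≤ _ := by gcongr
    have a2 : 0 ≤ C₂ * Rφ * ε := by positivity
    linarith
  have hcmp := cutKernel_compare hde hL hRφ h1 h2 hφR hC₁ hC₂ hC₁0.le hC₂0.le hd1 hD0 hB.le hBD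
    hb hΔle
  set err : Ω × (Fin q → ℝ) × (Fin t → ℝ) → ENNReal := fun z => if ‖z.2.2‖ ≤ L then
    kernelError ((p : ℝ) / d - 1) C₁ D B (q * L ^ d) (b z.2.2) (powSum d z.2.1) else 0 with herr
  have hgm : Measurable fun z : (Fin t → ℝ) × ℝ =>
      kernelError ((p : ℝ) / d - 1) C₁ D B (q * L ^ d) (b z.1) z.2 :=
    measurable_kernelError.comp ((hbm.comp measurable_fst).prodMk measurable_snd)
  have hgm' : Measurable err :=
    Measurable.ite (measurableSet_le (by fun_prop) measurable_const)
      (hgm.comp (f := fun z : Ω × (Fin q → ℝ) × (Fin t → ℝ) => (z.2.2, powSum d z.2.1))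
        ((measurable_snd.comp measurable_snd).prodMk
          (measurable_powSum.comp (measurable_fst.comp measurable_snd)))) measurable_const
  have hI1 : ∫⁻ z, err z ∂(μ.prod volume) ≤ ENNReal.ofReal (m0 * (c * C₃ * vol) * B ^ θ) := by
    refine (lintegral_fiber_le μ hc hgm (K := ENNReal.ofReal (C₃ * B ^ θ))
      fun y hy => hC₃ B (b y) hB hB1 (hb y hy)).trans (le_of_eq ?_)
    rw [hm0', hvol', ← ENNReal.ofReal_mul (by positivity), ← ENNReal.ofReal_mul (by positivity),
      ← ENNReal.ofReal_mul (by positivity)]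
    congr 1
    ring
  have hI2 := lintegral_shellKernel_le μ hdN (by omega) hν hφ hfin hΔ0 hΔ1
  have hsum : ENNReal.ofReal (m0 * (c * C₃ * vol) * B ^ θ) +
      ENNReal.ofReal (n * 2 ^ n * c0 * Δ) ≤
      ENNReal.ofReal ((m0 * (c * C₃ * vol) + n * 2 ^ n * c0 * Q + 1) * (ε + B ^ θ)) := by
    rw [← ENNReal.ofReal_add (by positivity) (by positivity)]
    apply ENNReal.ofReal_le_ofReal
    have a1 : 0 ≤ m0 * (c * C₃ * vol) * ε := by positivity
    rw [hΔdef]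
    linarith
  have hbd : ∀ f g : Ω × (Fin q → ℝ) × (Fin t → ℝ) → ENNReal, Measurable g →
      (∀ z, f z ≤ g z + err z + shellKernel d ν φ Δ z) →
      ∫⁻ z, f z ∂(μ.prod volume) ≤ ∫⁻ z, g z ∂(μ.prod volume) +
        ENNReal.ofReal ((m0 * (c * C₃ * vol) + n * 2 ^ n * c0 * Q + 1) * (ε + B ^ θ)) := by
    intro f g hg hfg
    calc ∫⁻ z, f z ∂(μ.prod volume) ≤ ∫⁻ z, (g z + err z + shellKernel d ν φ Δ z) ∂(μ.prod volume) :=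
          lintegral_mono hfg
      _ = ∫⁻ z, g z ∂(μ.prod volume) + ∫⁻ z, err z ∂(μ.prod volume) +
          ∫⁻ z, shellKernel d ν φ Δ z ∂(μ.prod volume) := by
          rw [lintegral_add_left (show Measurable fun z => g z + err z from hg.add hgm'), lintegral_add_left hg]
      _ ≤ _ := by
          rw [add_assoc]
          gcongr
          exact (add_le_add hI1 hI2).trans hsum
  exact ⟨hbd _ _ (measurable_cutKernel hν hφ (b := 0) measurable_const 0 1) fun z => (hcmp z).1,
    hbd _ _ (measurable_cutKernel hν hφ hbm e 1) fun z => (hcmp z).2⟩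

end Estimate

/-! ### The distribution of the values of `(F₀, M₀)` -/

/-- For fixed remaining variables, the translation ω = a + S makes the value a of the form the
variable of integration in place of the radial ω. Tonelli then brings a and the block C, which
carries the values of `M₀`, to the outside. -/
lemma lintegral_shift_swap {Ω A B C : Type*} [MeasurableSpace Ω] [MeasurableSpace A]
    [MeasurableSpace B] [MeasurableSpace C] (μ : Measure Ω) [SFinite μ] (μA : Measure A)
    [SFinite μA] (μB : Measure B) [SFinite μB] (μC : Measure C) [SFinite μC]
    {H : Ω × ℝ × A × B × C → ENNReal} (hH : Measurable H) {S : A × B × C → ℝ} (hS : Measurable S) :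
    ∫⁻ u, ∫⁻ ω : ℝ, ∫⁻ v, H (u, ω, v) ∂(μA.prod (μB.prod μC)) ∂volume ∂μ =
      ∫⁻ a : ℝ × C, ∫⁻ z : Ω × A × B,
        H (z.1, a.1 + S (z.2.1, z.2.2, a.2), z.2.1, z.2.2, a.2) ∂(μ.prod (μA.prod μB))
          ∂((volume : Measure ℝ).prod μC) := by
  set H' : Ω × A × B × C × ℝ → ENNReal := fun z =>
    H (z.1, z.2.2.2.2 + S (z.2.1, z.2.2.1, z.2.2.2.1), z.2.1, z.2.2.1, z.2.2.2.1) with hH'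
  have hm : Measurable H' := by fun_prop
  have hl : ∀ u, ∫⁻ ω : ℝ, ∫⁻ v, H (u, ω, v) ∂(μA.prod (μB.prod μC)) =
      ∫⁻ x, ∫⁻ y, ∫⁻ w, ∫⁻ a : ℝ, H' (u, x, y, w, a) ∂volume ∂μC ∂μB ∂μA := by
    intro u
    rw [lintegral_lintegral_swap (Measurable.aemeasurable (by fun_prop))]
    have : ∀ v : A × B × C, ∫⁻ ω : ℝ, H (u, ω, v) =
        ∫⁻ a : ℝ, H' (u, v.1, v.2.1, v.2.2, a) := fun v =>
      (lintegral_add_right_eq_self (fun ω => H (u, ω, v)) (S v)).symm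
    simp only [this]
    rw [lintegral_prod _ (Measurable.aemeasurable (by fun_prop))]
    refine lintegral_congr fun x => ?_
    rw [lintegral_prod _ (Measurable.aemeasurable (by fun_prop))]
  simp only [hl]
  conv_rhs =>
    rw [lintegral_lintegral_swap (Measurable.aemeasurable (by fun_prop)),
      lintegral_prod _ (Measurable.aemeasurable (by fun_prop))]
  refine lintegral_congr fun u => ?_
  conv_rhs => rw [lintegral_prod _ (Measurable.aemeasurable (by fun_prop))]
  refine lintegral_congr fun x => lintegral_congr fun y => ?_
  conv_rhs => rw [lintegral_prod_symm _ (Measurable.aemeasurable (by fun_prop))]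

section Coordinates

variable {p q t s : ℕ}

/-- The regrouping of the coordinates into the two blocks of `x`, the block `Y₁` and the block
`(Y₂, Z)`. -/
def idxEquiv (p q t s : ℕ) : SrcIdx p q t s ≃ Fin p ⊕ (Fin q ⊕ (Fin t ⊕ TgtIdx t s)) :=
  (Equiv.sumAssoc _ _ _).trans
    ((Equiv.refl _).sumCongr ((Equiv.refl _).sumCongr (Equiv.sumAssoc _ _ _)))

/-- The linear isomorphism putting the four groups of coordinates together. -/
def assemble (p q t s : ℕ) :
    ((Fin p → ℝ) × (Fin q → ℝ) × (Fin t → ℝ) × (TgtIdx t s → ℝ)) →ₗ[ℝ] (SrcIdx p q t s → ℝ) where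
  toFun v i := Sum.elim v.1 (Sum.elim v.2.1 (Sum.elim v.2.2.1 v.2.2.2)) (idxEquiv p q t s i)
  map_add' v w := by
    ext i
    rcases i with (i | i) | ((i | i) | i) <;> rfl
  map_smul' c v := by
    ext i
    rcases i with (i | i) | ((i | i) | i) <;> rfl

lemma assemble_injective : Function.Injective (assemble p q t s) := by
  intro v w h
  have h' : ∀ j, Sum.elim v.1 (Sum.elim v.2.1 (Sum.elim v.2.2.1 v.2.2.2)) j =
      Sum.elim w.1 (Sum.elim w.2.1 (Sum.elim w.2.2.1 w.2.2.2)) j := fun j => by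
    simpa [assemble] using congrFun h ((idxEquiv p q t s).symm j)
  refine Prod.ext (funext fun i => h' (.inl i)) (Prod.ext (funext fun i => h' (.inr (.inl i)))
    (Prod.ext (funext fun i => h' (.inr (.inr (.inl i))))
      (funext fun i => h' (.inr (.inr (.inr i))))))

lemma measurePreserving_assemble : MeasurePreserving (assemble p q t s) := by
  have s1 := volume_measurePreserving_sumPiEquivProdPi_symm (fun _ : Fin t ⊕ TgtIdx t s => ℝ)
  have s2 := volume_measurePreserving_sumPiEquivProdPi_symm
    (fun _ : Fin q ⊕ (Fin t ⊕ TgtIdx t s) => ℝ)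
  have s3 := volume_measurePreserving_sumPiEquivProdPi_symm
    (fun _ : Fin p ⊕ (Fin q ⊕ (Fin t ⊕ TgtIdx t s)) => ℝ)
  have r1 := (MeasurePreserving.id (volume : Measure (Fin q → ℝ))).prod s1
  have r2 := (MeasurePreserving.id (volume : Measure (Fin p → ℝ))).prod (s2.comp r1)
  have s4 := volume_preserving_arrowCongr' (idxEquiv p q t s).symm (MeasurableEquiv.refl ℝ)
    (MeasurePreserving.id volume)
  refine cast (congrArg (fun f => MeasurePreserving f volume volume) ?_) (s4.comp (s3.comp r2))
  ext v i
  rcases i with (i | i) | ((i | i) | i) <;> rfl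

lemma M₀_assemble (v : (Fin p → ℝ) × (Fin q → ℝ) × (Fin t → ℝ) × (TgtIdx t s → ℝ)) :
    M₀ (assemble p q t s v) = v.2.2.2 := by
  ext i
  rcases i with i | i <;> rfl

/-- The contribution of `P₁` and `P₂` to the value of `F₀`. -/
def lowerPart (P₁ : MvPolynomial (Fin t ⊕ Fin t) ℝ) (P₂ : MvPolynomial (Fin s) ℝ)
    (y : Fin t → ℝ) (w : TgtIdx t s → ℝ) : ℝ :=
  MvPolynomial.eval (Sum.elim y fun k => w (Sum.inl k)) P₁ +
    MvPolynomial.eval (fun k => w (Sum.inr k)) P₂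

lemma F₀_assemble (d : ℕ) (P₁ : MvPolynomial (Fin t ⊕ Fin t) ℝ) (P₂ : MvPolynomial (Fin s) ℝ)
    (v : (Fin p → ℝ) × (Fin q → ℝ) × (Fin t → ℝ) × (TgtIdx t s → ℝ)) :
    F₀ d P₁ P₂ (assemble p q t s v) =
      powSum d v.1 - powSum d v.2.1 + lowerPart P₁ P₂ v.2.2.1 v.2.2.2 := by
  have h1 : (fun k => assemble p q t s v (Sum.inr (Sum.inl k))) =
      Sum.elim v.2.2.1 fun k => v.2.2.2 (Sum.inl k) := by
    ext k
    rcases k with k | k <;> rfl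
  unfold F₀
  rw [h1, lowerPart, ← add_assoc]
  rfl

@[fun_prop]
lemma measurable_eval_mvPolynomial {σ : Type*} [Finite σ] (P : MvPolynomial σ ℝ) :
    Measurable fun x : σ → ℝ => MvPolynomial.eval x P :=
  (MvPolynomial.continuous_eval P).measurable

lemma measurable_lowerPart (P₁ : MvPolynomial (Fin t ⊕ Fin t) ℝ) (P₂ : MvPolynomial (Fin s) ℝ) :
    Measurable fun z : (Fin t → ℝ) × (TgtIdx t s → ℝ) => lowerPart P₁ P₂ z.1 z.2 := by
  refine Measurable.add ((measurable_eval_mvPolynomial P₁).comp ?_) (by fun_prop)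
  refine measurable_pi_iff.2 fun k => ?_
  rcases k with k | k
  · simp only [Sum.elim_inl]; fun_prop
  · simp only [Sum.elim_inr]; fun_prop

lemma measurable_F₀ (d : ℕ) (P₁ : MvPolynomial (Fin t ⊕ Fin t) ℝ) (P₂ : MvPolynomial (Fin s) ℝ) :
    Measurable (F₀ d P₁ P₂ : (SrcIdx p q t s → ℝ) → ℝ) := by
  unfold F₀
  fun_prop

lemma measurable_M₀ : Measurable (M₀ : (SrcIdx p q t s → ℝ) →ₗ[ℝ] _) :=
  (LinearMap.continuous_of_finiteDimensional _).measurable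

variable {Ω : Type*} [MeasurableSpace Ω]

/-- The values of `(F₀, M₀)` on the ball of radius `T` are distributed with an explicit density. -/
lemma lintegral_region_eq (μ : Measure Ω) [SFinite μ] {φ : Ω → Fin p → ℝ} {d : ℕ} (hd : 0 < d)
    (hφ : Measurable φ) (hφ1 : ∀ u, powSum d (φ u) = 1)
    (hpolar : ∀ f : (Fin p → ℝ) → ENNReal, Measurable f →
        ∫⁻ x, f x = ∫⁻ u, (∫⁻ w in Set.Ioi (0 : ℝ), f (w ^ ((d : ℝ)⁻¹) • φ u) *
          ENNReal.ofReal (w ^ ((p : ℝ) / d - 1))) ∂μ)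
    (P₁ : MvPolynomial (Fin t ⊕ Fin t) ℝ) (P₂ : MvPolynomial (Fin s) ℝ)
    {N : Seminorm ℝ (SrcIdx p q t s → ℝ)} (hN : Continuous N) (T : ℝ)
    {g : ℝ × (TgtIdx t s → ℝ) → ENNReal} (hg : Measurable g) :
    ∫⁻ v in N.closedBall 0 T, g (F₀ d P₁ P₂ v, M₀ v) =
      ∫⁻ a, g a * ∫⁻ z, cutKernel d (N.comp (assemble p q t s)) φ
        (fun y => a.1 - lowerPart P₁ P₂ y a.2) a.2 T z ∂(μ.prod volume) := by
  have hball' : N.closedBall 0 T = {v | N v ≤ T} := by ext v; simp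
  have hball : MeasurableSet (N.closedBall 0 T) := by
    rw [hball']
    exact measurableSet_le hN.measurable measurable_const
  have hemb : Measurable (assemble p q t s) := measurePreserving_assemble.measurable
  have hlow := measurable_lowerPart P₁ P₂
  have hF : Measurable (F₀ d P₁ P₂ : (SrcIdx p q t s → ℝ) → ℝ) := measurable_F₀ d P₁ P₂
  have hM : Measurable (M₀ : (SrcIdx p q t s → ℝ) →ₗ[ℝ] _) := measurable_M₀
  set G : (SrcIdx p q t s → ℝ) → ENNReal :=
    fun v => if N v ≤ T then g (F₀ d P₁ P₂ v, M₀ v) else 0 with hG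
  have hGm : Measurable G := Measurable.ite (measurableSet_le hN.measurable measurable_const)
    (by fun_prop) measurable_const
  have hGi : ∫⁻ v in N.closedBall 0 T, g (F₀ d P₁ P₂ v, M₀ v) = ∫⁻ v, G v := by
    rw [← lintegral_indicator hball]
    refine lintegral_congr fun v => ?_
    by_cases hv : N v ≤ T
    · rw [Set.indicator_of_mem (by simpa using hv)]; simp [hG, hv]
    · rw [Set.indicator_of_notMem (by simpa using hv)]; simp [hG, hv]
  rw [hGi]
  rw [← measurePreserving_assemble.lintegral_comp hGm, Measure.volume_eq_prod,
    lintegral_prod _ (Measurable.aemeasurable (by fun_prop)),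
    hpolar _ (by fun_prop)]
  set H : Ω × ℝ × (Fin q → ℝ) × (Fin t → ℝ) × (TgtIdx t s → ℝ) → ENNReal := fun z =>
    ENNReal.ofReal (posRpow ((p : ℝ) / d - 1) z.2.1) *
      if N (assemble p q t s (posRpow ((d : ℝ)⁻¹) z.2.1 • φ z.1, z.2.2)) ≤ T then
        g (z.2.1 - powSum d z.2.2.1 + lowerPart P₁ P₂ z.2.2.2.1 z.2.2.2.2, z.2.2.2.2) else 0
    with hH
  have hlow' : Measurable fun z : Ω × ℝ × (Fin q → ℝ) × (Fin t → ℝ) × (TgtIdx t s → ℝ) =>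
      lowerPart P₁ P₂ z.2.2.2.1 z.2.2.2.2 :=
    hlow.comp (f := fun z : Ω × ℝ × (Fin q → ℝ) × (Fin t → ℝ) × (TgtIdx t s → ℝ) =>
      (z.2.2.2.1, z.2.2.2.2)) (by fun_prop)
  have hHm : Measurable H := by
    refine Measurable.mul (by fun_prop) (Measurable.ite (measurableSet_le ?_ measurable_const)
      ?_ measurable_const)
    · exact hN.measurable.comp (hemb.comp (by fun_prop))
    · fun_prop
  have hkey : ∀ u : Ω, ∫⁻ w in Set.Ioi (0 : ℝ),
      (∫⁻ v, G (assemble p q t s (w ^ ((d : ℝ)⁻¹) • φ u, v))) *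
        ENNReal.ofReal (w ^ ((p : ℝ) / d - 1)) =
      ∫⁻ w : ℝ, ∫⁻ v, H (u, w, v) ∂(volume.prod (volume.prod volume)) := by
    intro u
    rw [← lintegral_indicator measurableSet_Ioi]
    refine lintegral_congr fun w => ?_
    rcases le_or_gt w 0 with hw | hw
    · rw [Set.indicator_of_notMem (by simpa using hw)]
      simp [hH, posRpow_of_nonpos _ hw]
    · rw [Set.indicator_of_mem (show w ∈ Set.Ioi (0 : ℝ) from hw), mul_comm,
        ← lintegral_const_mul' _ _ ENNReal.ofReal_ne_top]
      refine lintegral_congr fun v => ?_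
      simp only [hH, posRpow_of_pos _ hw, hG, F₀_assemble, M₀_assemble, powSum_smul, hφ1, mul_one,
        Real.rpow_inv_natCast_pow hw.le hd.ne']
  simp only [hkey]
  -- Here w = F₀ + `powSum d x` - `lowerPart`, so the new variable is the value of `F₀`.
  rw [lintegral_shift_swap μ volume volume volume hHm
    (S := fun v => powSum d v.1 - lowerPart P₁ P₂ v.2.1 v.2.2)
    (Measurable.sub (by fun_prop) (hlow.comp measurable_snd))]
  rw [← Measure.volume_eq_prod, ← Measure.volume_eq_prod]
  refine lintegral_congr fun a => ?_
  have hb : Measurable fun y => a.1 - lowerPart P₁ P₂ y a.2 :=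
    (hlow.comp (measurable_prodMk_right (y := a.2))).const_sub a.1
  have hNc : Continuous (N.comp (assemble p q t s)) :=
    hN.comp (assemble p q t s).continuous_of_finiteDimensional
  have hcm : Measurable (cutKernel d (N.comp (assemble p q t s)) φ
      (fun y => a.1 - lowerPart P₁ P₂ y a.2) a.2 T) := measurable_cutKernel hNc hφ hb a.2 T
  rw [← lintegral_const_mul _ hcm]
  refine lintegral_congr fun z => ?_
  have e1 : a.1 + (powSum d z.2.1 - lowerPart P₁ P₂ z.2.2 a.2) =
      a.1 - lowerPart P₁ P₂ z.2.2 a.2 + powSum d z.2.1 := by ring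
  have e2 : a.1 - lowerPart P₁ P₂ z.2.2 a.2 + powSum d z.2.1 - powSum d z.2.1 +
      lowerPart P₁ P₂ z.2.2 a.2 = a.1 := by ring
  simp only [hH, e1, e2]
  by_cases hc : N (assemble p q t s (posRpow ((d : ℝ)⁻¹)
      (a.1 - lowerPart P₁ P₂ z.2.2 a.2 + powSum d z.2.1) • φ z.1, z.2.1, z.2.2, a.2)) ≤ T
  · rw [if_pos hc, mul_comm]
    exact congrArg (g a * ·) (if_pos hc).symm
  · rw [if_neg hc, mul_zero, ← mul_zero (g a)]
    exact congrArg (g a * ·) (if_neg hc).symm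

end Coordinates

/-! ### Volume estimate for `(F₀, M₀)` -/

/-- Equivalence of norms: a seminorm on a finite-dimensional space is convex, hence continuous, and
both it and its inverse are bounded on the compact unit sphere. -/
lemma exists_seminorm_bounds {E : Type*} [NormedAddCommGroup E] [NormedSpace ℝ E]
    [FiniteDimensional ℝ E] (ν : Seminorm ℝ E) (hν : ∀ v, ν v = 0 → v = 0) :
    ∃ L : ℝ, 0 < L ∧ (∀ v, ν v ≤ L * ‖v‖) ∧ ∀ v, ‖v‖ ≤ L * ν v := by
  have hc : Continuous ν := by
    have h := ν.convexOn.continuousOn isOpen_univ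
    exact continuousOn_univ.1 h
  obtain ⟨M, hM⟩ := (isCompact_sphere (0 : E) 1).exists_bound_of_continuousOn hc.continuousOn
  have hcinv : ContinuousOn (fun v => (ν v)⁻¹) (Metric.sphere (0 : E) 1) :=
    hc.continuousOn.inv₀ fun v hv h => by
      rw [hν v h] at hv; simp at hv
  obtain ⟨M', hM'⟩ := (isCompact_sphere (0 : E) 1).exists_bound_of_continuousOn hcinv
  refine ⟨max (max M M') 1, by positivity, fun v => ?_, fun v => ?_⟩
  all_goals
    rcases eq_or_ne v 0 with rfl | hv
    · simp
    have hv0 : 0 < ‖v‖ := norm_pos_iff.2 hv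
    have hu : ‖v‖⁻¹ • v ∈ Metric.sphere (0 : E) 1 := by
      simp [norm_smul, hv0.ne']
    have e1 : ν (‖v‖⁻¹ • v) = ‖v‖⁻¹ * ν v := by
      rw [map_smul_eq_mul]; simp
    have hνv : 0 < ν v := lt_of_le_of_ne (apply_nonneg ν v) fun h => hv (hν v h.symm)
  · have h1 := (le_abs_self _).trans (hM _ hu)
    rw [e1, inv_mul_le_iff₀ hv0, mul_comm] at h1
    exact h1.trans (by gcongr; exact (le_max_left _ _).trans (le_max_left _ _))
  · have h1 := (le_abs_self _).trans (hM' _ hu)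
    rw [e1, mul_inv, inv_inv, ← div_eq_mul_inv, div_le_iff₀ hνv] at h1
    exact h1.trans (by gcongr; exact (le_max_right _ _).trans (le_max_left _ _))

section Region

variable {p q t s d : ℕ}

/-- The density of the values of `(F₀, M₀)` on a ball. -/
def density {Ω : Type*} [MeasurableSpace Ω] (μ : Measure Ω) (φ : Ω → Fin p → ℝ) (d : ℕ)
    (P₁ : MvPolynomial (Fin t ⊕ Fin t) ℝ) (P₂ : MvPolynomial (Fin s) ℝ)
    (N : Seminorm ℝ (SrcIdx p q t s → ℝ)) (T : ℝ) (a : ℝ × (TgtIdx t s → ℝ)) : ENNReal :=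
  ∫⁻ z, cutKernel d (N.comp (assemble p q t s)) φ
    (fun y => a.1 - lowerPart P₁ P₂ y a.2) a.2 T z ∂(μ.prod volume)

lemma measurable_level (P₁ : MvPolynomial (Fin t ⊕ Fin t) ℝ) (P₂ : MvPolynomial (Fin s) ℝ) :
    Measurable fun z : (ℝ × (TgtIdx t s → ℝ)) × (Fin t → ℝ) =>
      z.1.1 - lowerPart P₁ P₂ z.2 z.1.2 := by
  have h := (measurable_lowerPart P₁ P₂).comp
    (measurable_snd.prodMk (measurable_snd.comp measurable_fst) :
      Measurable fun z : (ℝ × (TgtIdx t s → ℝ)) × (Fin t → ℝ) => (z.2, z.1.2))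
  exact (measurable_fst.comp measurable_fst).sub h

/-- Identifying the whole law of `(F₀, M₀)` on the ball as a measure with density shows it to be
absolutely continuous, so sets I that are only null-measurable are admissible. -/
lemma volume_region_eq {Ω : Type*} [MeasurableSpace Ω] (μ : Measure Ω) [SFinite μ]
    {φ : Ω → Fin p → ℝ} (hd : 0 < d)
    (hφ : Measurable φ) (hφ1 : ∀ u, powSum d (φ u) = 1)
    (hpolar : ∀ f : (Fin p → ℝ) → ENNReal, Measurable f →
        ∫⁻ x, f x = ∫⁻ u, (∫⁻ w in Set.Ioi (0 : ℝ), f (w ^ ((d : ℝ)⁻¹) • φ u) *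
          ENNReal.ofReal (w ^ ((p : ℝ) / d - 1))) ∂μ)
    (P₁ : MvPolynomial (Fin t ⊕ Fin t) ℝ) (P₂ : MvPolynomial (Fin s) ℝ)
    {N : Seminorm ℝ (SrcIdx p q t s → ℝ)} (hN : Continuous N) (T : ℝ)
    {I : Set (ℝ × (TgtIdx t s → ℝ))} (hI : NullMeasurableSet I volume) :
    volume (region (F₀ d P₁ P₂) M₀ N I T) = ∫⁻ a in I, density μ φ d P₁ P₂ N T a := by
  have hFM : Measurable fun v : SrcIdx p q t s → ℝ => (F₀ d P₁ P₂ v, M₀ v) :=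
    (measurable_F₀ d P₁ P₂).prodMk measurable_M₀
  have hball : MeasurableSet (N.closedBall 0 T) := by
    have : N.closedBall 0 T = {v | N v ≤ T} := by ext v; simp
    rw [this]
    exact measurableSet_le hN.measurable measurable_const
  have hNc : Continuous (N.comp (assemble p q t s)) :=
    hN.comp (assemble p q t s).continuous_of_finiteDimensional
  have hmap : (volume.restrict (N.closedBall 0 T)).map
      (fun v : SrcIdx p q t s → ℝ => (F₀ d P₁ P₂ v, M₀ v)) =
      volume.withDensity (density μ φ d P₁ P₂ N T) := by
    ext S hS
    rw [withDensity_apply _ hS, Measure.map_apply hFM hS, ← lintegral_indicator_one (hFM hS)]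
    have h := lintegral_region_eq μ hd hφ hφ1 hpolar P₁ P₂ hN T
      (g := S.indicator 1) (measurable_one.indicator hS)
    rw [← lintegral_indicator hS]
    refine Eq.trans ?_ (h.trans ?_)
    · rfl
    · refine lintegral_congr fun a => ?_
      by_cases ha : a ∈ S
      · simp [ha, density]
      · simp [ha]
  have hI' : NullMeasurableSet I ((volume.restrict (N.closedBall 0 T)).map
      (fun v : SrcIdx p q t s → ℝ => (F₀ d P₁ P₂ v, M₀ v))) := by
    rw [hmap]
    exact hI.mono_ac (withDensity_absolutelyContinuous _ _)
  have h1 := Measure.map_apply₀ hFM.aemeasurable hI'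
  rw [hmap, withDensity_apply₀ _ hI, Measure.restrict_apply' hball] at h1
  exact h1.symm

/-- Integrates a pointwise two-sided bound. No measurability of f is needed: monotonicity suffices,
and the only summand split off is constant. -/
lemma abs_setLIntegral_sub_le {X : Type*} [MeasurableSpace X] {μ : Measure X} {I : Set X}
    (hI : NullMeasurableSet I μ) (hIfin : μ I ≠ ⊤) {f : X → ENNReal} {c e : ℝ}
    (h1 : ∀ x ∈ I, f x ≤ ENNReal.ofReal c + ENNReal.ofReal e)
    (h2 : ∀ x ∈ I, ENNReal.ofReal c ≤ f x + ENNReal.ofReal e) (hc : 0 ≤ c) (he : 0 ≤ e) :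
    |(∫⁻ x in I, f x ∂μ).toReal - c * μ.real I| ≤ e * μ.real I := by
  have i1 : ∫⁻ x in I, f x ∂μ ≤ (ENNReal.ofReal c + ENNReal.ofReal e) * μ I := by
    rw [← setLIntegral_const]
    exact lintegral_mono_ae ((ae_restrict_iff'₀ hI).2 (Eventually.of_forall h1))
  have i2 : ENNReal.ofReal c * μ I ≤ ∫⁻ x in I, f x ∂μ + ENNReal.ofReal e * μ I := by
    rw [← setLIntegral_const, ← setLIntegral_const, ← lintegral_add_right _ measurable_const]
    exact lintegral_mono_ae ((ae_restrict_iff'₀ hI).2 (Eventually.of_forall h2))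
  have hfin : ∫⁻ x in I, f x ∂μ ≠ ⊤ := ne_top_of_le_ne_top
    (ENNReal.mul_ne_top (ENNReal.add_ne_top.2 ⟨ENNReal.ofReal_ne_top, ENNReal.ofReal_ne_top⟩)
      hIfin) i1
  have r1 := ENNReal.toReal_mono (ENNReal.mul_ne_top
    (ENNReal.add_ne_top.2 ⟨ENNReal.ofReal_ne_top, ENNReal.ofReal_ne_top⟩) hIfin) i1
  have r2 := ENNReal.toReal_mono (ENNReal.add_ne_top.2 ⟨hfin,
    ENNReal.mul_ne_top ENNReal.ofReal_ne_top hIfin⟩) i2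
  rw [ENNReal.toReal_mul, ENNReal.toReal_add ENNReal.ofReal_ne_top ENNReal.ofReal_ne_top,
    ENNReal.toReal_ofReal hc, ENNReal.toReal_ofReal he] at r1
  rw [ENNReal.toReal_mul, ENNReal.toReal_add hfin (ENNReal.mul_ne_top ENNReal.ofReal_ne_top hIfin),
    ENNReal.toReal_mul, ENNReal.toReal_ofReal hc, ENNReal.toReal_ofReal he] at r2
  change _ ≤ (c + e) * μ.real I at r1
  change c * μ.real I ≤ _ + e * μ.real I at r2
  rw [abs_le]
  constructor <;> linarith

/-- The volume of the part of a ball on which `(F₀, M₀)` takes its values in a set `I`, when the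
values in `I` are small in comparison with the radius. -/
theorem exists_volume_region_estimate (hd : 2 ≤ d) (hde : Even d) (hp : 1 ≤ p) (hq : 1 ≤ q)
    (hpq : d + 1 ≤ p + q) (P₁ : MvPolynomial (Fin t ⊕ Fin t) ℝ) (P₂ : MvPolynomial (Fin s) ℝ)
    (N : Seminorm ℝ (SrcIdx p q t s → ℝ)) (hN : ∀ v, N v = 0 → v = 0) :
    ∃ c : ℝ, 0 < c ∧ ∃ C : ℝ, 0 < C ∧ ∃ η : ℝ, 0 < η ∧ ∃ L : ℝ, 0 < L ∧
      ∀ T B ε : ℝ, 0 < T → 0 < B → 0 ≤ ε → ε + B ^ (((p : ℝ) + q - d) / (p + q - 1)) ≤ η →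
      ∀ I : Set (ℝ × (TgtIdx t s → ℝ)), NullMeasurableSet I volume → volume I ≠ ⊤ →
        (∀ a ∈ I, ‖a.2‖ ≤ ε * T) →
        (∀ a ∈ I, ∀ y : Fin t → ℝ, ‖y‖ ≤ L * T → |a.1 - lowerPart P₁ P₂ y a.2| ≤ B * T ^ d) →
        |volume.real (region (F₀ d P₁ P₂) M₀ N I T)
            - c * volume.real I * T ^ (p + q - d + t)| ≤
          C * (volume.real I *
            (T ^ (p + q - d + t) * (ε + B ^ (((p : ℝ) + q - d) / (p + q - 1))))) := by
  have hdN : 0 < d := by omega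
  obtain ⟨L₀, -, hL₀, -⟩ := exists_seminorm_bounds N hN
  have hNc := continuous_of_le_mul_norm hL₀
  have hν' : ∀ v, N.comp (assemble p q t s) v = 0 → v = 0 := fun v hv =>
    assemble_injective (by rw [map_zero]; exact hN _ hv)
  obtain ⟨L, hL, h1, h2⟩ := exists_seminorm_bounds (N.comp (assemble p q t s)) hν'
  have hν := continuous_of_le_mul_norm h1
  obtain ⟨μ, φ, Rφ, hμ, hμ0, hφ, hφR, hφ1, hpolar⟩ := exists_polar hdN hde hp
  have hφR' : ∀ u, ‖φ u‖ ≤ max Rφ 0 := fun u => (hφR u).trans (le_max_left _ _)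
  have hRφ0 : 0 ≤ max Rφ 0 := le_max_right _ _
  obtain ⟨C, hC, η, hη, hest⟩ := exists_cutKernel_estimate μ hd hde hp hq hpq hφ hL.le hRφ0 h1 h2
    hφR'
  set c : ENNReal := ∫⁻ z, cutKernel d (N.comp (assemble p q t s)) φ 0 0 1 z ∂(μ.prod volume)
    with hc
  have hcfin : c < ⊤ := lintegral_cutKernel_zero_lt_top μ hd hde hp hq hpq hL.le h2
  have hcpos : 0 < c := lintegral_cutKernel_zero_pos μ hμ0 hdN hde hq hν hφ hL.le h1 hRφ0 hφR'
  refine ⟨c.toReal, ENNReal.toReal_pos hcpos.ne' hcfin.ne, C, hC, η, hη, L, hL,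
    fun T B ε hT hB hε hsmall I hI hIfin hI2 hI1 => ?_⟩
  set θ : ℝ := ((p : ℝ) + q - d) / (p + q - 1)
  set n := p + q - d + t
  have hBθ : 0 < B ^ θ := by positivity
  have hTn : 0 < T ^ n := by positivity
  have key : ∀ a ∈ I, density μ φ d P₁ P₂ N T a ≤
        ENNReal.ofReal (T ^ n * c.toReal) + ENNReal.ofReal (T ^ n * (C * (ε + B ^ θ))) ∧
      ENNReal.ofReal (T ^ n * c.toReal) ≤ density μ φ d P₁ P₂ N T a +
        ENNReal.ofReal (T ^ n * (C * (ε + B ^ θ))) := by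
    intro a ha
    have hbm : Measurable fun y => a.1 - lowerPart P₁ P₂ y a.2 :=
      (measurable_level P₁ P₂).comp (measurable_prodMk_left (x := a))
    have hbm' : Measurable fun y : Fin t → ℝ => (a.1 - lowerPart P₁ P₂ (T • y) a.2) / T ^ d :=
      (hbm.comp (measurable_const_smul T)).div_const _
    have e1 : density μ φ d P₁ P₂ N T a = _ :=
      lintegral_cutKernel_scale μ hdN (by omega) hν hφ hbm a.2 hT
    obtain ⟨g1, g2⟩ := hest _ (T⁻¹ • a.2) B ε hbm' hB hε hsmall (fun y hy => by
        rw [abs_div, abs_of_pos (by positivity : (0 : ℝ) < T ^ d), div_le_iff₀ (by positivity)]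
        refine hI1 a ha _ ?_
        rw [norm_smul, Real.norm_of_nonneg hT.le, mul_comm]
        gcongr) (by
        rw [norm_smul, Real.norm_of_nonneg (by positivity), inv_mul_le_iff₀ hT, mul_comm]
        exact hI2 a ha)
    rw [e1, ENNReal.ofReal_mul hTn.le, ENNReal.ofReal_mul hTn.le, ENNReal.ofReal_toReal hcfin.ne,
      ← mul_add, ← mul_add]
    exact ⟨by gcongr, by gcongr⟩
  have hfinal := abs_setLIntegral_sub_le hI hIfin (fun a ha => (key a ha).1)
    (fun a ha => (key a ha).2) (by positivity) (by positivity)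
  rw [← volume_region_eq μ hdN hφ hφ1 hpolar P₁ P₂ hNc T hI] at hfinal
  calc _ = |(volume (region (F₀ d P₁ P₂) M₀ N I T)).toReal -
        T ^ n * c.toReal * volume.real I| := by
        rw [measureReal_def]; congr 1; ring
    _ ≤ _ := hfinal
    _ = _ := by ring

end Region

/-! ### The size of the lower-order polynomials -/

section LowerPartBound

lemma natDegree_le_of_isBigO {Q : Polynomial ℝ} {k : ℕ}
    (h : (fun T : ℝ => Q.eval T) =O[atTop] fun T : ℝ => T ^ k) : Q.natDegree ≤ k := by
  by_contra hlt
  have hdeg : (Polynomial.X ^ k : Polynomial ℝ).degree < Q.degree := by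
    rw [Polynomial.degree_X_pow]
    rw [Polynomial.degree_eq_natDegree (by rintro rfl; simp at hlt)]
    exact_mod_cast not_le.1 hlt
  have h1 := Polynomial.isLittleO_atTop_of_degree_lt _ _ hdeg
  have h2 := h1.trans_isBigO h
  simp only [Polynomial.eval_pow, Polynomial.eval_X] at h2
  refine Asymptotics.isLittleO_irrefl ?_ h2
  exact ((eventually_gt_atTop (0 : ℝ)).mono fun T hT => (by positivity : T ^ k ≠ 0)).frequently

variable {t s : ℕ}

/-- Under the growth hypothesis, each monomial has degree at most `d'` in the first block. -/
lemma sum_inl_le_of_hasGrowth {P₁ : MvPolynomial (Fin t ⊕ Fin t) ℝ} {d' : ℕ}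
    (h : HasGrowth P₁ d') {m : (Fin t ⊕ Fin t) →₀ ℕ} (hm : m ∈ P₁.support) :
    ∑ k, m (Sum.inl k) ≤ d' := by
  set wt : ((Fin t ⊕ Fin t) →₀ ℕ) → ℕ := fun m => ∑ k, m (Sum.inl k) with hwt
  by_contra hlt
  -- `R` collects the monomials with the same degree in Y₁ as m. Its value at x is the coefficient
  -- of T^(wt m) in P₁(T Y₁, Y₂), which the growth hypothesis forces to vanish when wt m > d'. A
  -- polynomial vanishing at every point is zero, contradicting m ∈ supp P₁; growth along each ray
  -- thus controls every monomial.
  set R : MvPolynomial (Fin t ⊕ Fin t) ℝ :=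
    ∑ m' ∈ P₁.support with wt m' = wt m, MvPolynomial.monomial m' (P₁.coeff m') with hR
  have hR0 : R = 0 := by
    apply MvPolynomial.funext
    intro x
    set Q : Polynomial ℝ := ∑ m' ∈ P₁.support,
      Polynomial.C (P₁.coeff m' * ∏ i, x i ^ m' i) * Polynomial.X ^ wt m' with hQ
    have hev : ∀ T : ℝ, Q.eval T = MvPolynomial.eval
        (Sum.elim (fun k => T * x (Sum.inl k)) fun k => x (Sum.inr k)) P₁ := by
      intro T
      rw [MvPolynomial.eval_eq', hQ, Polynomial.eval_finsetSum]
      refine Finset.sum_congr rfl fun m' _ => ?_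
      simp only [Polynomial.eval_mul, Polynomial.eval_C, Polynomial.eval_pow, Polynomial.eval_X,
        Fintype.prod_sum_type, Sum.elim_inl, Sum.elim_inr, mul_pow, Finset.prod_mul_distrib,
        Finset.prod_pow_eq_pow_sum, hwt]
      ring
    have hdeg : Q.natDegree ≤ d' := by
      apply natDegree_le_of_isBigO
      simp only [hev]
      exact h (fun k => x (Sum.inl k)) (fun k => x (Sum.inr k))
    have hcoeff : Q.coeff (wt m) = 0 :=
      Polynomial.coeff_eq_zero_of_natDegree_lt (hdeg.trans_lt (not_le.1 hlt))
    rw [map_zero, ← hcoeff, hQ, hR, map_sum, Polynomial.finsetSum_coeff, Finset.sum_filter]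
    refine Finset.sum_congr rfl fun m' _ => ?_
    rw [Polynomial.coeff_C_mul_X_pow]
    simp only [eq_comm (a := wt m')]
    split_ifs
    · rw [MvPolynomial.eval_monomial, Finsupp.prod_fintype _ _ (fun _ => pow_zero _)]
    · rfl
  have hcm : R.coeff m = P₁.coeff m := by
    rw [hR, MvPolynomial.coeff_sum]
    simp only [MvPolynomial.coeff_monomial]
    rw [Finset.sum_ite_eq', if_pos (by simpa using hm)]
  rw [hR0, MvPolynomial.coeff_zero] at hcm
  exact (MvPolynomial.mem_support_iff.1 hm) hcm.symm

/-- Since 1 ≤ N ≤ T, first raise the total degree to D with powers of N, then trade k - i of these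
for powers of T. -/
lemma pow_mul_pow_le {T N : ℝ} (hN : 1 ≤ N) (hNT : N ≤ T) {i j k D : ℕ} (hik : i ≤ k)
    (hkD : k ≤ D) (hij : i + j ≤ D) : T ^ i * N ^ j ≤ T ^ k * N ^ (D - k) := by
  have hN0 : 0 < N := by linarith
  have hT0 : 0 < T := by linarith
  calc T ^ i * N ^ j ≤ T ^ i * N ^ ((k - i) + (D - k)) := by
        gcongr T ^ i * ?_
        exact pow_le_pow_right₀ hN (by omega)
    _ = T ^ i * N ^ (k - i) * N ^ (D - k) := by rw [pow_add]; ring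
    _ ≤ T ^ i * T ^ (k - i) * N ^ (D - k) := by gcongr
    _ = T ^ k * N ^ (D - k) := by rw [← pow_add]; congr 2; omega

/-- Each monomial of P₁ has degree at most d' in the long variables y and total degree at most D; P₂
involves only short variables. The extremal case is T^d' N^(D-d'). -/
lemma exists_abs_lowerPart_le {P₁ : MvPolynomial (Fin t ⊕ Fin t) ℝ} {P₂ : MvPolynomial (Fin s) ℝ}
    {d' D : ℕ} (h : HasGrowth P₁ d') (hd' : d' ≤ D) (hD₁ : P₁.totalDegree ≤ D)
    (hD₂ : P₂.totalDegree ≤ D) {R : ℝ} (hR : 1 ≤ R) :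
    ∃ C : ℝ, 0 < C ∧ ∀ (T N : ℝ), 1 ≤ N → N ≤ T → ∀ (y : Fin t → ℝ) (w : TgtIdx t s → ℝ),
      ‖y‖ ≤ R * T → ‖w‖ ≤ N → |lowerPart P₁ P₂ y w| ≤ C * (T ^ d' * N ^ (D - d')) := by
  refine ⟨∑ m ∈ P₁.support, |P₁.coeff m| * R ^ d' + ∑ m ∈ P₂.support, |P₂.coeff m| + 1,
    by positivity, fun T N hN hNT y w hy hw => ?_⟩
  have hN0 : 0 < N := by linarith
  have hT0 : 0 < T := by linarith
  have hX : 0 < T ^ d' * N ^ (D - d') := by positivity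
  have b1 : |MvPolynomial.eval (Sum.elim y fun k => w (Sum.inl k)) P₁| ≤
      (∑ m ∈ P₁.support, |P₁.coeff m| * R ^ d') * (T ^ d' * N ^ (D - d')) := by
    rw [MvPolynomial.eval_eq', Finset.sum_mul]
    refine (Finset.abs_sum_le_sum_abs _ _).trans (Finset.sum_le_sum fun m hm => ?_)
    rw [abs_mul, mul_assoc]
    refine mul_le_mul_of_nonneg_left ?_ (abs_nonneg _)
    have hi := sum_inl_le_of_hasGrowth h hm
    have hij : ∑ k, m (Sum.inl k) + ∑ k, m (Sum.inr k) ≤ D := by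
      have := MvPolynomial.le_totalDegree hm
      rw [Finsupp.sum_fintype _ _ (fun _ => rfl), Fintype.sum_sum_type] at this
      exact this.trans hD₁
    rw [Fintype.prod_sum_type, abs_mul, Finset.abs_prod, Finset.abs_prod]
    simp only [Sum.elim_inl, Sum.elim_inr, abs_pow]
    calc (∏ k, |y k| ^ m (Sum.inl k)) * ∏ k, |w (Sum.inl k)| ^ m (Sum.inr k)
        ≤ (∏ k, (R * T) ^ m (Sum.inl k)) * ∏ k, N ^ m (Sum.inr k) := by
          gcongr with k _ k _
          · exact (norm_le_pi_norm y k).trans hy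
          · exact (norm_le_pi_norm w _).trans hw
      _ = R ^ (∑ k, m (Sum.inl k)) * (T ^ (∑ k, m (Sum.inl k)) * N ^ (∑ k, m (Sum.inr k))) := by
          rw [Finset.prod_pow_eq_pow_sum, Finset.prod_pow_eq_pow_sum, mul_pow, mul_assoc]
      _ ≤ R ^ d' * (T ^ d' * N ^ (D - d')) := by
          refine mul_le_mul (pow_le_pow_right₀ hR hi) ?_ (by positivity) (by positivity)
          exact pow_mul_pow_le hN hNT hi hd' hij
  have b2 : |MvPolynomial.eval (fun k => w (Sum.inr k)) P₂| ≤
      (∑ m ∈ P₂.support, |P₂.coeff m|) * (T ^ d' * N ^ (D - d')) := by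
    rw [MvPolynomial.eval_eq', Finset.sum_mul]
    refine (Finset.abs_sum_le_sum_abs _ _).trans (Finset.sum_le_sum fun m hm => ?_)
    rw [abs_mul]
    refine mul_le_mul_of_nonneg_left ?_ (abs_nonneg _)
    have hj : ∑ k, m k ≤ D := by
      have := MvPolynomial.le_totalDegree hm
      rw [Finsupp.sum_fintype _ _ (fun _ => rfl)] at this
      exact this.trans hD₂
    rw [Finset.abs_prod]
    simp only [abs_pow]
    calc ∏ k, |w (Sum.inr k)| ^ m k ≤ ∏ k, N ^ m k := by
          gcongr with k _
          exact (norm_le_pi_norm w _).trans hw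
      _ = T ^ 0 * N ^ (∑ k, m k) := by rw [Finset.prod_pow_eq_pow_sum]; simp
      _ ≤ T ^ d' * N ^ (D - d') := pow_mul_pow_le hN hNT (Nat.zero_le _) hd' (by omega)
  calc |lowerPart P₁ P₂ y w| ≤ _ := abs_add_le _ _
    _ ≤ _ := add_le_add b1 b2
    _ ≤ _ := by rw [← add_mul]; exact mul_le_mul_of_nonneg_right (by linarith) hX.le

end LowerPartBound

/-! ### Transfer to systems in the orbit -/

section Orbit

variable {p q t s d : ℕ}

/-- The volume estimate for a system in the orbit of `(F₀, M₀)`. -/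
theorem exists_orbit_volume_estimate (hd : 2 ≤ d) (hde : Even d) (hp : 1 ≤ p) (hq : 1 ≤ q)
    (hpq : d + 1 ≤ p + q) {d' D : ℕ} (hd' : d' < d) (hD : d ≤ D)
    {P₁ : MvPolynomial (Fin t ⊕ Fin t) ℝ} {P₂ : MvPolynomial (Fin s) ℝ}
    (hP₁ : HasGrowth P₁ d') (hD₁ : P₁.totalDegree ≤ D) (hD₂ : P₂.totalDegree ≤ D)
    (ν : Seminorm ℝ (SrcIdx p q t s → ℝ)) (hν : ∀ v, ν v = 0 → v = 0)
    {F : (SrcIdx p q t s → ℝ) → ℝ} {M : (SrcIdx p q t s → ℝ) →ₗ[ℝ] (TgtIdx t s → ℝ)}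
    (hFM : (F, M) ∈ Y p q t s d P₁ P₂) :
    ∃ c : ℝ, 0 < c ∧ ∃ C : ℝ, 0 < C ∧ ∃ η : ℝ, 0 < η ∧
      ∀ N T : ℝ, 1 ≤ N → N / T ≤ η → 0 < T → N ^ (D - d') / T ^ (d - d') ≤ η →
      ∀ I : Set (ℝ × (TgtIdx t s → ℝ)), NullMeasurableSet I volume → I ⊆ box t s N →
        |volume.real (region F M ν I T) - c * volume.real I * T ^ (p + q - d + t)| ≤
          C * (volume.real I * (T ^ (p + q - d + t) * (N / T +
            (N ^ (D - d') / T ^ (d - d')) ^ (((p : ℝ) + q - d) / (p + q - 1))))) := by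
  obtain ⟨lam, g₁, g₂, hlam, hF, hM⟩ := hFM
  simp only at hF hM
  have hm : (d : ℝ) + 1 ≤ p + q := by exact_mod_cast hpq
  have hm1 : (0 : ℝ) < (p : ℝ) + q - 1 := by
    have : (2 : ℝ) ≤ d := by exact_mod_cast hd
    linarith
  set θ : ℝ := ((p : ℝ) + q - d) / (p + q - 1) with hθ
  have hθ0 : 0 < θ := div_pos (by linarith) hm1
  set n := p + q - d + t
  -- the change of variables in the source
  set A : (SrcIdx p q t s → ℝ) →ₗ[ℝ] (SrcIdx p q t s → ℝ) :=
    Matrix.toLin' (g₁ : Matrix (SrcIdx p q t s) (SrcIdx p q t s) ℝ)ᵀ with hA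
  have hAv : ∀ v, A v = v ᵥ* (g₁ : Matrix (SrcIdx p q t s) (SrcIdx p q t s) ℝ) := fun v => by
    rw [hA, Matrix.toLin'_apply, Matrix.mulVec_transpose]
  have hAdet : LinearMap.det A = 1 := by
    rw [hA, LinearMap.det_toLin', Matrix.det_transpose, Matrix.SpecialLinearGroup.det_coe]
  set A' : (SrcIdx p q t s → ℝ) →ₗ[ℝ] (SrcIdx p q t s → ℝ) :=
    Matrix.toLin' ((g₁⁻¹ : Matrix.SpecialLinearGroup (SrcIdx p q t s) ℝ) :
      Matrix (SrcIdx p q t s) (SrcIdx p q t s) ℝ)ᵀ with hA'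
  have hA'A : ∀ v, A' (A v) = v := fun v => by
    rw [hAv, hA', Matrix.toLin'_apply, Matrix.mulVec_transpose, Matrix.vecMul_vecMul,
      ← Matrix.SpecialLinearGroup.coe_mul, mul_inv_cancel, Matrix.SpecialLinearGroup.coe_one,
      Matrix.vecMul_one]
  have hAA' : ∀ v, A (A' v) = v := fun v => by
    rw [hAv, hA', Matrix.toLin'_apply, Matrix.mulVec_transpose, Matrix.vecMul_vecMul,
      ← Matrix.SpecialLinearGroup.coe_mul, inv_mul_cancel, Matrix.SpecialLinearGroup.coe_one,
      Matrix.vecMul_one]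
  have hN' : ∀ v, ν.comp A' v = 0 → v = 0 := fun v hv => by
    rw [← hAA' v, hν _ hv, map_zero]
  -- the change of variables in the target
  set Λ : (ℝ × (TgtIdx t s → ℝ)) →ₗ[ℝ] (ℝ × (TgtIdx t s → ℝ)) :=
    LinearMap.prodMap (lam • LinearMap.id)
      (Matrix.toLin' (g₂ : Matrix (TgtIdx t s) (TgtIdx t s) ℝ)ᵀ) with hΛ
  have hΛv : ∀ a, Λ a = (lam * a.1, a.2 ᵥ* (g₂ : Matrix (TgtIdx t s) (TgtIdx t s) ℝ)) :=
    fun a => by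
      rw [hΛ, LinearMap.prodMap_apply, Matrix.toLin'_apply, Matrix.mulVec_transpose]
      rfl
  have hΛ0 : ∀ a, Λ a = 0 → a = 0 := by
    intro a ha
    rw [hΛv, Prod.mk_eq_zero] at ha
    refine Prod.ext ((mul_eq_zero.1 ha.1).resolve_left hlam) ?_
    have h2 : (a.2 ᵥ* (g₂ : Matrix (TgtIdx t s) (TgtIdx t s) ℝ)) ᵥ*
        ((g₂⁻¹ : GL (TgtIdx t s) ℝ) : Matrix (TgtIdx t s) (TgtIdx t s) ℝ) = a.2 := by
      rw [Matrix.vecMul_vecMul, Units.mul_inv, Matrix.vecMul_one]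
    rw [← h2, ha.2, Matrix.zero_vecMul]
    rfl
  have hΛdet : LinearMap.det Λ ≠ 0 := fun h => by
    have h3 := LinearMap.bot_lt_ker_of_det_eq_zero h
    rw [LinearMap.ker_eq_bot'.2 hΛ0] at h3
    exact lt_irrefl _ h3
  have hHaar : (volume : Measure (ℝ × (TgtIdx t s → ℝ))).IsAddHaarMeasure :=
    Measure.prod.instIsAddHaarMeasure volume volume
  set δ : ℝ := |(LinearMap.det Λ)⁻¹| with hδ
  have hδ0 : 0 < δ := abs_pos.2 (inv_ne_zero hΛdet)
  obtain ⟨κ₀, -, -, hκ₀⟩ := exists_seminorm_bounds ((normSeminorm ℝ (ℝ × (TgtIdx t s → ℝ))).comp Λ)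
    (fun a ha => hΛ0 a (norm_eq_zero.1 ha))
  -- κ bounds the inverse of Λ: pulling I back to values of `(F₀, M₀)` enlarges the box to size κN
  -- and multiplies its volume by δ.
  set κ : ℝ := max κ₀ 1 with hκ
  have hκ1 : 1 ≤ κ := le_max_right _ _
  have hκΛ : ∀ a, ‖a‖ ≤ κ * ‖Λ a‖ := fun a =>
    (hκ₀ a).trans (mul_le_mul_of_nonneg_right (le_max_left _ _) (norm_nonneg (Λ a)))
  obtain ⟨c, hc, C, hC, η, hη, L, hL, hest⟩ := exists_volume_region_estimate hd hde hp hq hpq P₁ P₂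
    (ν.comp A') hN'
  obtain ⟨K, hK, hlow⟩ := exists_abs_lowerPart_le hP₁ (hd'.le.trans hD) hD₁ hD₂ (le_max_right L 1)
  set e := D - d' with he
  -- The factor K + 1 accounts for the lower-order part and for the value of the form itself; κ^e
  -- comes from the enlarged box.
  set K' : ℝ := (K + 1) * κ ^ e with hK'
  have hK'0 : 0 < K' := by positivity
  -- a constant absorbing all the others
  set Q : ℝ := κ + K' ^ θ with hQ
  have hQ0 : 0 < Q := by positivity
  -- The first inequality gives κN ≤ T, required to bound the lower-order part; the second meets the
  -- smallness condition of the estimate for `(F₀, M₀)`.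
  obtain ⟨η', hη'0, hη'1, hη'2⟩ : ∃ η' : ℝ, 0 < η' ∧ κ * η' ≤ 1 ∧
      κ * η' + K' ^ θ * η' ^ θ ≤ η := by
    have hlim : Tendsto (fun x : ℝ => κ * x + K' ^ θ * x ^ θ) (nhdsWithin 0 (Set.Ioi 0))
        (nhds (κ * 0 + K' ^ θ * (0 : ℝ) ^ θ)) := by
      refine Tendsto.mono_left ?_ nhdsWithin_le_nhds
      have h1 : ContinuousAt (fun x : ℝ => κ * x + K' ^ θ * x ^ θ) 0 :=
        (continuousAt_const.mul continuousAt_id).add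
          (continuousAt_const.mul (continuousAt_id.rpow_const (Or.inr hθ0.le)))
      exact h1
    rw [Real.zero_rpow hθ0.ne', mul_zero, mul_zero, add_zero] at hlim
    have hev := hlim.eventually (eventually_le_nhds hη)
    have hev2 : ∀ᶠ x : ℝ in nhdsWithin 0 (Set.Ioi 0), x ∈ Set.Ioc 0 (1 / κ) :=
      Ioc_mem_nhdsGT (by positivity)
    obtain ⟨x, hx1, hx2⟩ := (hev.and hev2).exists
    refine ⟨x, hx2.1, ?_, hx1⟩
    have := hx2.2
    rw [le_div_iff₀ (by positivity)] at this
    linarith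
  refine ⟨c * δ, by positivity, C * δ * Q, by positivity, η', hη'0,
    fun N T hN hNT hT hβ I hI hIN => ?_⟩
  set β : ℝ := N ^ e / T ^ (d - d') with hβdef
  have hN0 : 0 < N := by linarith
  have hβ0 : 0 < β := by positivity
  have hκN1 : 1 ≤ κ * N := one_le_mul_of_one_le_of_one_le hκ1 hN
  have hκNT : κ * N ≤ T := by
    have h1 : κ * (N / T) ≤ 1 := (mul_le_mul_of_nonneg_left hNT (by positivity)).trans hη'1
    rw [← mul_div_assoc, div_le_one hT] at h1
    exact h1
  have hreg : volume.real (region F M ν I T) =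
      volume.real (region (F₀ d P₁ P₂) M₀ (ν.comp A') (Λ ⁻¹' I) T) := by
    have hpre : region F M ν I T = A ⁻¹' region (F₀ d P₁ P₂) M₀ (ν.comp A') (Λ ⁻¹' I) T := by
      ext v
      have hval : Λ (F₀ d P₁ P₂ (A v), M₀ (A v)) = (F v, M v) := by rw [hΛv, hF, hM, hAv]
      change (F v, M v) ∈ I ∧ v ∈ ν.closedBall 0 T ↔
        Λ (F₀ d P₁ P₂ (A v), M₀ (A v)) ∈ I ∧ A v ∈ (ν.comp A').closedBall 0 T
      rw [hval, Seminorm.mem_closedBall_zero, Seminorm.mem_closedBall_zero, Seminorm.comp_apply,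
        hA'A]
    rw [measureReal_def, measureReal_def, hpre, Measure.addHaar_preimage_linearMap _
      (by rw [hAdet]; exact one_ne_zero), hAdet]
    simp
  have hvol : volume (Λ ⁻¹' I) = ENNReal.ofReal δ * volume I :=
    Measure.addHaar_preimage_linearMap _ hΛdet I
  have hvolr : volume.real (Λ ⁻¹' I) = δ * volume.real I := by
    rw [measureReal_def, hvol, ENNReal.toReal_mul, ENNReal.toReal_ofReal hδ0.le]; rfl
  have hbox : ∀ a ∈ I, ‖a‖ ≤ N := fun a ha => by
    obtain ⟨h1, h2⟩ := hIN ha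
    exact norm_prod_le_iff.2 ⟨h1, (pi_norm_le_iff_of_nonneg hN0.le).2 h2⟩
  have hIfin : volume I ≠ ⊤ := by
    refine (Bornology.IsBounded.measure_lt_top ?_).ne
    exact isBounded_iff_forall_norm_le.2 ⟨N, hbox⟩
  have hbox' : ∀ a ∈ Λ ⁻¹' I, ‖a‖ ≤ κ * N := fun a ha =>
    (hκΛ a).trans (mul_le_mul_of_nonneg_left (hbox _ ha) (by positivity))
  have hEq : T ^ d' * (κ * N) ^ e * (K + 1) = K' * β * T ^ d := by
    have : T ^ d = T ^ d' * T ^ (d - d') := by rw [← pow_add]; congr 1; omega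
    rw [hK', hβdef, this, mul_pow]
    field_simp
  have hmain := hest T (K' * β) (κ * (N / T)) hT (by positivity) (by positivity) (by
      rw [Real.mul_rpow hK'0.le hβ0.le]
      refine le_trans ?_ hη'2
      gcongr) (Λ ⁻¹' I) (hI.preimage (Measure.LinearMap.quasiMeasurePreserving _ _ hΛdet))
      (by rw [hvol]; exact ENNReal.mul_ne_top ENNReal.ofReal_ne_top hIfin)
      (fun a ha => by
        have : κ * (N / T) * T = κ * N := by field_simp
        rw [this]
        exact (norm_snd_le a).trans (hbox' a ha))
      (fun a ha y hy => by
        have ha1 : |a.1| ≤ κ * N := (norm_fst_le a).trans (hbox' a ha)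
        have ha2 : ‖a.2‖ ≤ κ * N := (norm_snd_le a).trans (hbox' a ha)
        have h3 := hlow T (κ * N) hκN1 hκNT y a.2
          (hy.trans (mul_le_mul_of_nonneg_right (le_max_left _ _) hT.le)) ha2
        have h4 : κ * N ≤ T ^ d' * (κ * N) ^ e := by
          have := pow_mul_pow_le hκN1 hκNT (i := 0) (j := 1) (k := d') (D := D) (Nat.zero_le _)
            (by omega) (by omega)
          simpa using this
        rw [← hEq]
        calc |a.1 - lowerPart P₁ P₂ y a.2| ≤ |a.1| + |lowerPart P₁ P₂ y a.2| := abs_sub _ _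
          _ ≤ T ^ d' * (κ * N) ^ e + K * (T ^ d' * (κ * N) ^ e) :=
            add_le_add (ha1.trans h4) h3
          _ = _ := by ring)
  rw [← hreg, hvolr] at hmain
  calc _ = |volume.real (region F M ν I T) - c * (δ * volume.real I) * T ^ n| := by
        congr 1; ring
    _ ≤ _ := hmain
    _ ≤ C * (δ * volume.real I * (T ^ n * (Q * (N / T + β ^ θ)))) := by
        have hV : 0 ≤ volume.real I := measureReal_nonneg
        gcongr
        rw [Real.mul_rpow hK'0.le hβ0.le, hQ]
        have a1 : 0 ≤ κ * β ^ θ := by positivity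
        have a2 : 0 ≤ K' ^ θ * (N / T) := by positivity
        linarith
    _ = _ := by ring

/-! ### Comparison with the three-case error term -/

/-- The saving in the error term over the main term. -/
def errorRatio (p q d d' : ℕ) (ξ N T : ℝ) : ℝ :=
  if p + q < 2 * d - 1 then N ^ ξ * T ^ (-ξ)
  else if p + q = 2 * d - 1 ∧ d - d' = 1 then N ^ (1 / 2 : ℝ) * T ^ (-(1 / 2) : ℝ) * Real.log T
  else N ^ (1 / 2 : ℝ) * T ^ (-(1 / 2) : ℝ)

lemma errorSize_eq {n r d' : ℕ} (hn : n = p + q + 2 * t + s) (hr : r = t + s)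
    (hpq : d + 1 ≤ p + q) (ξ N : ℝ) {T : ℝ} (hT : 0 < T) :
    errorSize n r p q d d' ξ N T = T ^ (p + q - d + t) * errorRatio p q d d' ξ N T := by
  have e1 : ((n : ℝ) - r - d) = ((p + q - d + t : ℕ) : ℝ) := by
    rw [hn, hr, Nat.cast_add (p + q - d), Nat.cast_sub (by omega)]
    push_cast
    ring
  have e2 : ∀ x : ℝ, T ^ ((n : ℝ) - r - d - x) = T ^ (p + q - d + t) * T ^ (-x) := fun x => by
    rw [sub_eq_add_neg _ x, Real.rpow_add hT, e1, Real.rpow_natCast]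
  unfold errorSize errorRatio
  simp only [e2]
  split_ifs <;> ring

lemma one_le_log {T : ℝ} (hT : 3 ≤ T) : 1 ≤ Real.log T := by
  rw [Real.le_log_iff_exp_le (by linarith)]
  linarith [Real.exp_one_lt_d9]

lemma mul_rpow_neg_eq {N T : ℝ} (hN : 0 < N) (hT : 0 < T) (x : ℝ) :
    N ^ x * T ^ (-x) = (N / T) ^ x := by
  rw [Real.rpow_neg hT.le, Real.div_rpow hN.le hT.le, div_eq_mul_inv]

/-- N/T ≤ 1, so larger exponents give smaller powers, and T ≥ 3 makes the logarithm at least 1. -/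
lemma rpow_le_errorRatio {d' : ℕ} {ξ N T x : ℝ} (hN : 1 ≤ N)
    (hNT : N ≤ T) (hT : 3 ≤ T) (h1 : p + q < 2 * d - 1 → ξ ≤ x)
    (h2 : ¬ p + q < 2 * d - 1 → 1 / 2 ≤ x) : (N / T) ^ x ≤ errorRatio p q d d' ξ N T := by
  have hN0 : 0 < N := by linarith
  have hT0 : 0 < T := by linarith
  have hle : N / T ≤ 1 := (div_le_one hT0).2 hNT
  unfold errorRatio
  rw [mul_rpow_neg_eq hN0 hT0, mul_rpow_neg_eq hN0 hT0]
  split_ifs with ha hb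
  · exact Real.rpow_le_rpow_of_exponent_ge (by positivity) hle (h1 ha)
  · refine (Real.rpow_le_rpow_of_exponent_ge (by positivity) hle (h2 ha)).trans ?_
    exact le_mul_of_one_le_right (by positivity) (one_le_log hT)
  · exact Real.rpow_le_rpow_of_exponent_ge (by positivity) hle (h2 ha)

lemma div_le_errorRatio {d' : ℕ} {ξ N T : ℝ} (hξ : ξ < 1 / 2) (hN : 1 ≤ N)
    (hNT : N ≤ T) (hT : 3 ≤ T) : N / T ≤ errorRatio p q d d' ξ N T := by
  have := rpow_le_errorRatio (p := p) (q := q) (d := d) (d' := d') (ξ := ξ) (x := 1) hN hNT hT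
    (fun _ => by linarith) (fun _ => by norm_num)
  rwa [Real.rpow_one] at this

/-- θ ≥ 1/2 is equivalent to p + q ≥ 2d - 1, the origin of the division into cases. -/
lemma half_le_exponent (hd : 2 ≤ d) (h : ¬ p + q < 2 * d - 1) :
    (1 / 2 : ℝ) ≤ ((p : ℝ) + q - d) / (p + q - 1) := by
  have h1 : (2 * d - 1 : ℝ) ≤ p + q := by
    have : 2 * d ≤ p + q + 1 := by omega
    have : (2 * d : ℝ) ≤ p + q + 1 := by exact_mod_cast this
    linarith
  have h2 : (2 : ℝ) ≤ d := by exact_mod_cast hd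
  rw [div_le_div_iff₀ (by norm_num) (by linarith)]
  linarith

lemma pow_div_pow_rpow {N T : ℝ} (hN : 0 < N) (hT : 0 < T) (e k : ℕ) (θ : ℝ) :
    (N ^ e / T ^ k) ^ θ = N ^ ((e : ℝ) * θ) * T ^ (-((k : ℝ) * θ)) := by
  rw [Real.div_rpow (by positivity) (by positivity), Real.rpow_neg hT.le, ← Real.rpow_natCast,
    ← Real.rpow_natCast, ← Real.rpow_mul hN.le, ← Real.rpow_mul hT.le, div_eq_mul_inv]

/-- For a fixed size `N` of the values, the contribution of the lower order terms is eventually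
within the error term. -/
lemma eventually_le_errorRatio {d' : ℕ} (hd : 2 ≤ d) (hd' : d' < d) {ξ N : ℝ} (hN : 1 ≤ N)
    (hξ0 : 0 < ξ) (hξ : ξ < ((d : ℝ) - d') * (((p : ℝ) + q - d) / (p + q - 1))) (e : ℕ) :
    ∀ᶠ T : ℝ in atTop, (N ^ e / T ^ (d - d')) ^ (((p : ℝ) + q - d) / (p + q - 1)) ≤
      errorRatio p q d d' ξ N T := by
  set θ : ℝ := ((p : ℝ) + q - d) / (p + q - 1) with hθ
  have hN0 : 0 < N := by linarith
  have hk : ((d - d' : ℕ) : ℝ) = (d : ℝ) - d' := Nat.cast_sub hd'.le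
  -- If x < (d-d')θ, the spare power of T eventually absorbs the fixed power of N.
  have hpow : ∀ x : ℝ, 0 < x → x < ((d - d' : ℕ) : ℝ) * θ → ∀ᶠ T : ℝ in atTop,
      (N ^ e / T ^ (d - d')) ^ θ ≤ N ^ x * T ^ (-x) := by
    intro x hx0 hx
    have h1 := (tendsto_rpow_atTop (sub_pos.2 hx)).eventually_ge_atTop (N ^ ((e : ℝ) * θ))
    filter_upwards [h1, eventually_gt_atTop 0] with T hT hT0
    rw [pow_div_pow_rpow hN0 hT0]
    calc N ^ ((e : ℝ) * θ) * T ^ (-(((d - d' : ℕ) : ℝ) * θ))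
        ≤ T ^ (((d - d' : ℕ) : ℝ) * θ - x) * T ^ (-(((d - d' : ℕ) : ℝ) * θ)) := by gcongr
      _ = 1 * T ^ (-x) := by rw [← Real.rpow_add hT0, one_mul]; congr 1; ring
      _ ≤ _ := by
        gcongr
        exact Real.one_le_rpow hN hx0.le
  unfold errorRatio
  split_ifs with ha hb
  · exact hpow ξ hξ0 (by rw [hk]; exact hξ)
  -- In the borderline case (d-d')θ = 1/2 there is no spare power of T, and log T absorbs N^(eθ)
  -- instead.
  · have hθ2 : θ = 1 / 2 := by
      have h1 : (p : ℝ) + q = 2 * d - 1 := by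
        have : p + q + 1 = 2 * d := by omega
        have : (p : ℝ) + q + 1 = 2 * d := by exact_mod_cast this
        linarith
      have h2 : (2 : ℝ) ≤ d := by exact_mod_cast hd
      rw [hθ, h1, div_eq_div_iff (by linarith) (by norm_num)]
      ring
    have h1 := Real.tendsto_log_atTop.eventually_ge_atTop (N ^ ((e : ℝ) * θ))
    filter_upwards [h1, eventually_gt_atTop 0] with T hT hT0
    rw [pow_div_pow_rpow hN0 hT0, hb.2, Nat.cast_one, one_mul]
    calc N ^ ((e : ℝ) * θ) * T ^ (-θ) ≤ Real.log T * T ^ (-θ) := by gcongr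
      _ = 1 * (T ^ (-(1 / 2) : ℝ) * Real.log T) := by rw [hθ2]; ring
      _ ≤ N ^ (1 / 2 : ℝ) * (T ^ (-(1 / 2) : ℝ) * Real.log T) := by
        have hlog : 0 ≤ Real.log T := le_trans (by positivity) hT
        gcongr
        exact Real.one_le_rpow hN (by norm_num)
      _ = _ := by ring
  -- Here (d-d')θ > 1/2 strictly: either d - d' ≥ 2 and θ ≥ 1/2, or p + q ≥ 2d and θ > 1/2.
  · refine hpow (1 / 2) (by norm_num) ?_
    have hh := half_le_exponent hd ha
    rw [← hθ] at hh
    rcases Nat.lt_or_ge 1 (d - d') with h1 | h1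
    · have h2 : (2 : ℝ) ≤ ((d - d' : ℕ) : ℝ) := by exact_mod_cast h1
      nlinarith
    · have h2 : d - d' = 1 := by omega
      have h3 : 2 * d ≤ p + q := by
        have : p + q ≠ 2 * d - 1 := fun h => hb ⟨h, h2⟩
        omega
      have h4 : (2 * d : ℝ) ≤ p + q := by exact_mod_cast h3
      have h5 : (2 : ℝ) ≤ d := by exact_mod_cast hd
      rw [h2, Nat.cast_one, one_mul, hθ, div_lt_div_iff₀ (by norm_num) (by linarith)]
      linarith

end Orbit

end FormSystem

end

/-! ### Choice of T₀ and conclusion -/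

theorem theorem2p2
    (n r p q t s d d' : ℕ) (hn : n = p + q + 2 * t + s) (hr : r = t + s)
    (hp : 1 ≤ p) (hq : 1 ≤ q) (hd : 2 ≤ d) (hd_even : Even d) (hd'_pos : 0 < d') (hd' : d' < d)
    (hpq : d + 1 ≤ p + q)
    (P₁ : MvPolynomial (Fin t ⊕ Fin t) ℝ) (hP₁ : FormSystem.HasGrowth P₁ d')
    (P₂ : MvPolynomial (Fin s) ℝ)
    (ν : Seminorm ℝ (FormSystem.SrcIdx p q t s → ℝ)) (hν : ∀ v, ν v = 0 → v = 0)
    (F : (FormSystem.SrcIdx p q t s → ℝ) → ℝ)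
    (M : (FormSystem.SrcIdx p q t s → ℝ) →ₗ[ℝ] (FormSystem.TgtIdx t s → ℝ))
    (hFM : (F, M) ∈ FormSystem.Y p q t s d P₁ P₂) :
    ∃ c : ℝ, 0 < c ∧ ∃ C : ℝ, 0 < C ∧
      ∀ ξ : ℝ, 0 < ξ →
        ξ < min ((((d : ℝ) - d') * ((p : ℝ) + q - d)) / ((p : ℝ) + q - 1)) (1 / 2) →
        (∀ N : ℝ, 1 ≤ N → ∃ T₀ : ℝ, 0 < T₀ ∧
          ∀ I : Set (ℝ × (FormSystem.TgtIdx t s → ℝ)),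
            NullMeasurableSet I volume → I ⊆ FormSystem.box t s N →
            ∀ T : ℝ, T₀ * N < T →
              |volume.real (FormSystem.region F M ν I T)
                  - c * volume.real I * T ^ ((n : ℝ) - r - d)|
                ≤ C * (volume.real I * FormSystem.errorSize n r p q d d' ξ N T)) ∧
        (P₁.totalDegree ≤ d → P₂.totalDegree ≤ d → ∃ T₀ : ℝ, 0 < T₀ ∧
          ∀ N : ℝ, 1 ≤ N → ∀ I : Set (ℝ × (FormSystem.TgtIdx t s → ℝ)),
            NullMeasurableSet I volume → I ⊆ FormSystem.box t s N →
            ∀ T : ℝ, T₀ * N < T →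
              |volume.real (FormSystem.region F M ν I T)
                  - c * volume.real I * T ^ ((n : ℝ) - r - d)|
                ≤ C * (volume.real I * FormSystem.errorSize n r p q d d' ξ N T)) := by
  have hdpos : (0 : ℝ) < (d : ℝ) - d' := by
    have : (d' : ℝ) < d := by exact_mod_cast hd'
    linarith
  -- For D > d the ratio N^(D-d')/T^(d-d') is not controlled by N/T, so T₀ depends on N. The
  -- constants c and C are fixed before ξ; only T₀ may depend on ξ.
  set D := max (max P₁.totalDegree P₂.totalDegree) d with hD
  obtain ⟨c, hc, C, hC, η, hη, hest⟩ := FormSystem.exists_orbit_volume_estimate hd hd_even hp hq hpq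
    hd' (le_max_right _ _ : d ≤ D) hP₁ ((le_max_left _ _).trans (le_max_left _ _))
    ((le_max_right _ _).trans (le_max_left _ _)) ν hν hFM
  set θ : ℝ := ((p : ℝ) + q - d) / (p + q - 1) with hθ
  -- The factor 2 is for the two terms N/T and B^θ, each at most the error ratio.
  refine ⟨c, hc, 2 * C, by positivity, fun ξ hξ0 hξ => ?_⟩
  obtain ⟨hξ1, hξ2⟩ := lt_min_iff.1 hξ
  rw [mul_div_assoc, ← hθ] at hξ1
  have hpow : ∀ T : ℝ, T ^ ((n : ℝ) - r - d) = T ^ (p + q - d + t) := fun T => by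
    rw [← Real.rpow_natCast, hn, hr, Nat.cast_add (p + q - d), Nat.cast_sub (by omega)]
    congr 1
    push_cast
    ring
  have hfin : ∀ N T : ℝ, 1 ≤ N → N ≤ T → 3 ≤ T → N / T ≤ η →
      N ^ (D - d') / T ^ (d - d') ≤ η →
      (N ^ (D - d') / T ^ (d - d')) ^ θ ≤ FormSystem.errorRatio p q d d' ξ N T →
      ∀ I : Set (ℝ × (FormSystem.TgtIdx t s → ℝ)),
        NullMeasurableSet I volume → I ⊆ FormSystem.box t s N →
        |volume.real (FormSystem.region F M ν I T)
            - c * volume.real I * T ^ ((n : ℝ) - r - d)|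
          ≤ 2 * C * (volume.real I * FormSystem.errorSize n r p q d d' ξ N T) := by
    intro N T hN hNT hT hη1 hη2 hβ I hI hIN
    have hT0 : 0 < T := by linarith
    have h2 := FormSystem.div_le_errorRatio (p := p) (q := q) (d := d) (d' := d') hξ2 hN hNT hT
    have hV : 0 ≤ volume.real I := measureReal_nonneg
    rw [hpow, FormSystem.errorSize_eq hn hr hpq ξ N hT0]
    refine (hest N T hN hη1 hT0 hη2 I hI hIN).trans ?_
    set ρ := FormSystem.errorRatio p q d d' ξ N T
    calc _ ≤ C * (volume.real I * (T ^ (p + q - d + t) * (ρ + ρ))) := by gcongr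
      _ = _ := by ring
  constructor
  · intro N hN
    have hk : d - d' ≠ 0 := by omega
    have t1 : Tendsto (fun T : ℝ => N / T) atTop (nhds 0) :=
      tendsto_const_nhds.div_atTop tendsto_id
    have t2 : Tendsto (fun T : ℝ => N ^ (D - d') / T ^ (d - d')) atTop (nhds 0) :=
      tendsto_const_nhds.div_atTop (tendsto_pow_atTop hk)
    have hev := (((eventually_ge_atTop N).and (eventually_ge_atTop 3)).and
      ((t1.eventually (eventually_le_nhds hη)).and (t2.eventually (eventually_le_nhds hη)))).and
      (FormSystem.eventually_le_errorRatio (p := p) (q := q) hd hd' hN hξ0 hξ1 (D - d'))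
    obtain ⟨T₀, hT₀⟩ := eventually_atTop.1 hev
    refine ⟨max T₀ 1, by positivity, fun I hI hIN T hT => ?_⟩
    have h1 : T₀ ≤ T := by
      have : max T₀ 1 ≤ max T₀ 1 * N := le_mul_of_one_le_right (by positivity) hN
      exact (le_max_left _ _).trans (this.trans hT.le)
    obtain ⟨⟨⟨a1, a2⟩, a3, a4⟩, a5⟩ := hT₀ T h1
    exact hfin N T hN a1 a2 a3 a4 a5 I hI hIN
  · intro hdeg1 hdeg2
    have hDd : D = d := max_eq_right (max_le hdeg1 hdeg2)
    refine ⟨max 3 (1 / η), by positivity, fun N hN I hI hIN T hT => ?_⟩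
    have hN0 : 0 < N := by linarith
    have h3 : 3 * N ≤ T := (mul_le_mul_of_nonneg_right (le_max_left _ _) hN0.le).trans hT.le
    have h4 : 1 / η * N ≤ T := (mul_le_mul_of_nonneg_right (le_max_right _ _) hN0.le).trans hT.le
    have hT3 : 3 ≤ T := by linarith
    have hT0 : 0 < T := by linarith
    have hNT : N ≤ T := by linarith
    have hNη : N / T ≤ η := by
      rw [one_div, inv_mul_le_iff₀ hη] at h4
      rwa [div_le_iff₀ hT0]
    -- With D = d everything is a function of N/T, so a lower bound on T/N is enough, apart from T ≥
    -- 3, which follows from T ≥ 3N.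
    have hβ : N ^ (D - d') / T ^ (d - d') = (N / T) ^ (d - d') := by rw [hDd, div_pow]
    refine hfin N T hN hNT hT3 hNη ?_ ?_ I hI hIN
    · rw [hβ]
      exact (pow_le_of_le_one (by positivity) ((div_le_one hT0).2 hNT) (by omega)).trans hNη
    · rw [hβ, ← Real.rpow_natCast, ← Real.rpow_mul (by positivity)]
      have hk : ((d - d' : ℕ) : ℝ) = (d : ℝ) - d' := Nat.cast_sub hd'.le
      refine FormSystem.rpow_le_errorRatio hN hNT hT3 (fun _ => by rw [hk]; exact hξ1.le)
        fun h => ?_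
      have hh := FormSystem.half_le_exponent hd h
      rw [← hθ] at hh
      have h1 : (1 : ℝ) ≤ ((d - d' : ℕ) : ℝ) := by exact_mod_cast (by omega : 1 ≤ d - d')
      exact hh.trans (le_mul_of_one_le_left (by linarith) h1)
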